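/- Let $1\le k\le n$ be integers. Let $f:\mathbb R^n\to\mathbb R$ be continuously differentiable with $\|\nabla f(x)-\nabla f(x')\|\le L\|x-x'\|$ for all $x,x'$, where $L>0$, and let $\inf f>-\infty$. Let $\theta\in(0,1)$ and assume that $f$ satisfies the Łojasiewicz inequality with exponent $\theta$: for every $x^*$ with $\nabla f(x^*)=0$ there are $\kappa,\mu>0$ such that $|f(x)-f(x^*)|^\theta\le\kappa\|\nabla f(x)\|$ whenever $\|x-x^*\|\le\mu$. Let $V_0,V_1,\dots$ be independent random matrices, $V_t=[v_{t,1},\dots,v_{t,k}]$, uniformly distributed on the Stiefel manifold $\{V\in\mathbb R^{n\times k}:V^\top V=I_k\}$ (i.e. with the $O(n)$-invariant probability distribution on it). Fix $x_0\in\mathbb R^n$, $\delta_0\in(0,1]$ and a constant step size $\eta$ with $0<\eta<\frac{2k}{Ln}$. With $\delta_t=2^{-t}\delta_0$, let SZGD generate $$x_{t+1}=x_t-\eta\,\frac{n}{2\delta_t k}\sum_{i=1}^k\bigl(f(x_t+\delta_t v_{t,i})-f(x_t-\delta_t v_{t,i})\bigr)v_{t,i},\qquad t=0,1,2,\dots,$$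 and assume that almost surely the sequence $(x_t)_t$ is bounded. Then there is a random vector $x_\infty$ such that, almost surely, $x_t\to x_\infty$ and $\nabla f(x_\infty)=0$. Moreover: (a) Suppose $\theta\in(0,\frac12]$ and $-1\le\frac{Ln\eta^2}{2k}-\eta<0$. Then almost surely there is $Q>1$ (possibly depending on the outcome) with $Q^t\,(f(x_t)-f(x_\infty))\to0$. If, in addition, either one and the same constant $\kappa$ can be used in the Łojasiewicz inequality at all critical points (for instance $\kappa=1$; the radius $\mu$ may still vary), or there is a non-random $R$ with $\|x_t\|\le R$ for all $t$ almost surely, then there is a non-random constant $Q>1$ such that $Q^t\,(f(x_t)-f(x_\infty))\to0$ almost surely. (b) If $\theta\in(\frac12,1)$, then almost surely $f(x_t)-f(x_\infty)=O\bigl(t^{1/(1-2\theta)}\bigr)$ as $t\to\infty$. -/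

import Mathlib

open MeasureTheory ProbabilityTheory Filter Topology Asymptotics

namespace SZGD

noncomputable section

/-- Euclidean space `ℝⁿ`. -/
abbrev E (n : ℕ) : Type := EuclideanSpace ℝ (Fin n)

/-- `L`-smoothness: continuously differentiable with `L`-Lipschitz gradient. -/
def LSmooth {n : ℕ} (L : ℝ) (f : E n → ℝ) : Prop :=
  ContDiff ℝ 1 f ∧ ∀ x x' : E n, ‖gradient f x - gradient f x'‖ ≤ L * ‖x - x'‖

/-- The Łojasiewicz inequality with exponent `θ` and constant `κ`
on some closed ball centred at `xs`. -/
def LojasiewiczAt {n : ℕ} (θ κ : ℝ) (f : E n → ℝ) (xs : E n) : Prop :=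
  ∃ μ : ℝ, 0 < μ ∧ ∀ x : E n, ‖x - xs‖ ≤ μ → |f x - f xs| ^ θ ≤ κ * ‖gradient f x‖

/-- Differentiable Łojasiewicz function with exponent `θ ∈ (0,1)`; both `κ` and the radius
may depend on the critical point. -/
def IsLojasiewicz {n : ℕ} (θ : ℝ) (f : E n → ℝ) : Prop :=
  0 < θ ∧ θ < 1 ∧ Differentiable ℝ f ∧
    ∀ xs : E n, gradient f xs = 0 → ∃ κ : ℝ, 0 < κ ∧ LojasiewiczAt θ κ f xs

/-- The constant `κ` of the Łojasiewicz inequality can be chosen to be the same at all critical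
points (the radius may still vary); `κ = 1` is the usual normalisation. -/
def HasUniformLojasiewiczConstant {n : ℕ} (θ : ℝ) (f : E n → ℝ) : Prop :=
  ∃ κ : ℝ, 0 < κ ∧ ∀ xs : E n, gradient f xs = 0 → LojasiewiczAt θ κ f xs

/-- The Stiefel manifold `St(n,k)`: an `n × k` matrix with `Vᵀ V = I` is
given by its `k` columns, which are orthonormal. -/
def stiefel (n k : ℕ) : Set (Fin k → E n) := {V | Orthonormal ℝ V}

/-- `ν` is the uniform distribution on `St(n,k)`: the (unique) probability measure carried by
`St(n,k)` and invariant under the transitive action `V ↦ U V` of the orthogonal group. -/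
structure IsStiefelUniform {n k : ℕ} (ν : Measure (Fin k → E n)) : Prop where
  isProbabilityMeasure : IsProbabilityMeasure ν
  ae_mem : ∀ᵐ V ∂ν, V ∈ stiefel n k
  invariant : ∀ U : E n ≃ₗᵢ[ℝ] E n, ν.map (fun V i => U (V i)) = ν

/-- The uniform distribution on `St(n,k)` exists for `k ≤ n`. -/
theorem exists_isStiefelUniform {n k : ℕ} (hkn : k ≤ n) :
    ∃ ν : Measure (Fin k → E n), IsStiefelUniform ν := by
  have : ContinuousStar (E n →L[ℝ] E n) :=
    ⟨(ContinuousLinearMap.adjoint (𝕜 := ℝ) (E := E n) (F := E n)).continuous⟩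
  let G := unitary (E n →L[ℝ] E n)
  have hc : IsCompact (G : Set (E n →L[ℝ] E n)) := by
    have : ProperSpace (E n →L[ℝ] E n) := FiniteDimensional.proper ℝ _
    refine (isCompact_closedBall (0 : E n →L[ℝ] E n) 1).of_isClosed_subset isClosed_unitary ?_
    intro A hA
    rw [mem_closedBall_zero_iff]
    exact ContinuousLinearMap.opNorm_le_bound _ zero_le_one fun x => by
      simpa using (Unitary.norm_map (⟨A, hA⟩ : G) x).le
  have : CompactSpace G := isCompact_iff_compactSpace.mp hc
  let : MeasurableSpace G := borel G
  have : BorelSpace G := ⟨rfl⟩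
  let μ : Measure G := Measure.haarMeasure ⊤
  have : IsProbabilityMeasure μ := 
    ⟨Measure.haarMeasure_self (K₀ := (⊤ : TopologicalSpace.PositiveCompacts G))⟩
  let e : Fin k → E n := fun i => EuclideanSpace.basisFun (Fin n) ℝ (Fin.castLE hkn i)
  have he : Orthonormal ℝ e :=
    (EuclideanSpace.basisFun (Fin n) ℝ).orthonormal.comp _ (Fin.castLE_injective hkn)
  let φ : G → Fin k → E n := fun A i => A.1 (e i)
  have hφ : Continuous φ := by fun_prop
  refine ⟨μ.map φ, Measure.isProbabilityMeasure_map hφ.aemeasurable, ?_, ?_⟩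
  · refine (ae_map_iff hφ.aemeasurable ?_).2 (ae_of_all _ fun A => ?_)
    · have hS : IsClosed (stiefel n k) := by
        simp only [stiefel, orthonormal_iff_ite, Set.ofPred_forall]
        exact isClosed_iInter fun i => isClosed_iInter fun j =>
          isClosed_eq (by fun_prop) continuous_const
      exact hS.measurableSet
    · exact he.comp_linearIsometryEquiv (Unitary.linearIsometryEquiv A)
  · intro U
    have hU : Measurable (fun (V : Fin k → E n) i => U (V i)) := by fun_prop
    rw [Measure.map_map hU hφ.measurable]
    let g : G := Unitary.linearIsometryEquiv.symm U
    have : (fun (V : Fin k → E n) i => U (V i)) ∘ φ = φ ∘ (fun A => g * A) := by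
      funext A i
      simp [φ, g]
    rw [this, ← Measure.map_map hφ.measurable (measurable_const_mul g), map_mul_left_eq_self]

/-- The finite-difference gradient estimator with granularity `δ` and directions `v₁, …, v_k`. -/
def gradEst {n k : ℕ} (f : E n → ℝ) (δ : ℝ) (v : Fin k → E n) (x : E n) : E n :=
  ((n : ℝ) / (2 * δ * k)) • ∑ i, (f (x + δ • v i) - f (x - δ • v i)) • v i

/-- The SZGD iterates with constant step size `η`, granularity `δ_t = δ₀ 2^{-t}`, starting point
`x₀`, and direction frames `v 0, v 1, …`. -/
def szgd {n k : ℕ} (f : E n → ℝ) (η δ₀ : ℝ) (x₀ : E n) (v : ℕ → Fin k → E n) : ℕ → E n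
  | 0 => x₀
  | t + 1 => szgd f η δ₀ x₀ v t - η • gradEst f (δ₀ / 2 ^ t) (v t) (szgd f η δ₀ x₀ v t)

/-- The frames `V_0, V_1, …` are independent and uniformly distributed on `St(n,k)`. -/
structure IsStiefelSample {n k : ℕ} {Ω : Type*} [MeasurableSpace Ω] (P : Measure Ω)
    (V : ℕ → Ω → Fin k → E n) : Prop where
  measurable : ∀ t, Measurable (V t)
  uniform : ∀ t, IsStiefelUniform (P.map (V t))
  indep : iIndepFun V P

end

end SZGD

namespace SZGD

/-! ### One step of the iteration -/

/-! Write `G t` for the gradient norm at the iterate `x t` and `p t ∈ [0, 1]` for the squared length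
of the projection of the gradient's direction onto the frame. A step lowers `f` by at least `c * p t
* G t ^ 2` up to an error of order `4 ^ (-t)` (`LSmooth.exists_descent`). Adding `D / 4 ^ t` to `f`
absorbs the errors and gives a decreasing energy, whose excess over its limit is `a`
(`exists_isExcess`). The difficulty is that `p t` can be arbitrarily small; only its conditional
mean `k / n` given the past is known. Two probabilistic facts make up for this. If `∑ p Y` converges
for an adapted `Y ≥ 0` with `p Y` bounded by a constant, so does `∑ Y`
(`IsProjRatio.ae_tsum_ne_top`); and `∏ (1 - r p)` decays exponentially almost surely
(`IsProjRatio.ae_tendsto_prod`). Convergence: the energy gives `∑ p G² < ∞`, hence `∑ G² < ∞` and `G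
→ 0`, so the Łojasiewicz inequality is eventually available along the bounded path. Łojasiewicz's
length argument then gives `∑ p G < ∞`, hence `∑ G < ∞`, and the path has finite length. Rates: the
inequality turns descent into `a (t+1) ≤ a t - r * p t * a t ^ (2θ)`. For `θ ≤ 1/2` the exponent may
be raised to `1/2`, and `a` is dominated by the product above. For `θ > 1/2`, the decay of the
product forces `∑ p` to grow linearly, and `a ^ (1 - 2θ)` grows with it. -/

theorem LSmooth.hasGradientAt {n : ℕ} {L : ℝ} {f : E n → ℝ} (hf : LSmooth L f) (x : E n) :
    HasGradientAt f (gradient f x) x :=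
  (hf.1.differentiable one_ne_zero x).hasGradientAt

theorem LSmooth.continuous_gradient {n : ℕ} {L : ℝ} {f : E n → ℝ} (hf : LSmooth L f) :
    Continuous (gradient f) :=
  (LipschitzWith.of_dist_le' (K := L) fun x y => by
    simpa [dist_eq_norm] using hf.2 x y).continuous

/-- Along the segment the remainder has derivative at most `L * s * ‖h‖ ^ 2` in absolute value;
compare it with the primitive of this bound. -/
theorem LSmooth.abs_sub_sub_inner_le {n : ℕ} {L : ℝ} {f : E n → ℝ}
    (hf : LSmooth L f) (x h : E n) :
    |f (x + h) - f x - inner ℝ (gradient f x) h| ≤ L / 2 * ‖h‖ ^ 2 := by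
  let φ : ℝ → ℝ := fun s => f (x + s • h) - f x - s * inner ℝ (gradient f x) h
  have hφ : ∀ s, HasDerivAt φ (inner ℝ (gradient f (x + s • h) - gradient f x) h) s := by
    intro s
    have h1 : HasDerivAt (fun s : ℝ => x + s • h) h s := by
      simpa using ((hasDerivAt_id s).smul_const h).const_add x
    have h2 := (hf.hasGradientAt (x + s • h)).hasFDerivAt.comp_hasDerivAt s h1
    have h3 := (h2.sub_const (f x)).sub
      ((hasDerivAt_id s).mul_const (inner ℝ (gradient f x) h))
    rw [inner_sub_left]
    simpa [φ] using! h3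
  have hB : ∀ s : ℝ, HasDerivAt (fun s : ℝ => L / 2 * ‖h‖ ^ 2 * s ^ 2) (L * ‖h‖ ^ 2 * s) s := by
    intro s
    convert! (hasDerivAt_pow 2 s).const_mul (L / 2 * ‖h‖ ^ 2) using 1
    simp; ring
  have key := image_norm_le_of_norm_deriv_right_le_deriv_boundary (a := 0) (b := 1) (f := φ)
    (fun s _ => (hφ s).continuousAt.continuousWithinAt)
    (fun s _ => (hφ s).hasDerivWithinAt) (by simp [φ]) hB (by
      intro s hs
      refine (norm_inner_le_norm _ _).trans ?_
      have h1 := hf.2 (x + s • h) x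
      rw [add_sub_cancel_left, norm_smul, Real.norm_of_nonneg hs.1] at h1
      nlinarith [mul_le_mul_of_nonneg_right h1 (norm_nonneg h)])
    (Set.right_mem_Icc.2 zero_le_one)
  simpa [φ] using key

/-- The squared norm of the projection of `u` onto the span of an orthonormal frame `v`. -/
noncomputable def frameSq {n k : ℕ} (v : Fin k → E n) (u : E n) : ℝ := ∑ i, inner ℝ u (v i) ^ 2

theorem frameSq_nonneg {n k : ℕ} (v : Fin k → E n) (u : E n) : 0 ≤ frameSq v u :=
  Finset.sum_nonneg fun _ _ => sq_nonneg _

theorem frameSq_le {n k : ℕ} {v : Fin k → E n} (hv : v ∈ stiefel n k) (u : E n) :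
    frameSq v u ≤ ‖u‖ ^ 2 := by
  have := Orthonormal.sum_inner_products_le (s := Finset.univ) u (show Orthonormal ℝ v from hv)
  simpa [frameSq, real_inner_comm] using this

theorem frameSq_smul {n k : ℕ} (v : Fin k → E n) (a : ℝ) (u : E n) :
    frameSq v (a • u) = a ^ 2 * frameSq v u := by
  simp [frameSq, inner_smul_left, mul_pow, Finset.mul_sum]

theorem measurable_frameSq {n k : ℕ} {α : Type*} {_ : MeasurableSpace α} {v : α → Fin k → E n}
    {u : α → E n} (hv : Measurable v) (hu : Measurable u) :
    Measurable fun a => frameSq (v a) (u a) :=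
  Finset.measurable_fun_sum _ fun i _ =>
    (hu.inner ((measurable_pi_apply i).comp hv)).pow_const 2

/-- The central difference quotient of `f` at `x` in direction `v`. -/
noncomputable def centralDiff {n : ℕ} (f : E n → ℝ) (δ : ℝ) (x v : E n) : ℝ :=
  (f (x + δ • v) - f (x - δ • v)) / (2 * δ)

/-- Subtract the expansions at `δ • v` and `-(δ • v)`: each contributes an error `L δ² / 2`, and the
difference is divided by `2δ`. -/
theorem LSmooth.abs_centralDiff_sub_le {n : ℕ} {L : ℝ} {f : E n → ℝ} (hf : LSmooth L f)
    {δ : ℝ} (hδ : 0 < δ) (x : E n) {v : E n} (hv : ‖v‖ = 1) :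
    |centralDiff f δ x v - inner ℝ (gradient f x) v| ≤ L * δ / 2 := by
  have h1 := hf.abs_sub_sub_inner_le x (δ • v)
  have h2 := hf.abs_sub_sub_inner_le x (-(δ • v))
  rw [norm_neg, ← sub_eq_add_neg] at h2
  simp only [norm_smul, hv, inner_smul_right, inner_neg_right, Real.norm_of_nonneg hδ.le] at h1 h2
  rw [abs_le] at h1 h2 ⊢
  have e : centralDiff f δ x v - inner ℝ (gradient f x) v
      = (f (x + δ • v) - f (x - δ • v) - 2 * δ * inner ℝ (gradient f x) v) / (2 * δ) := by
    rw [centralDiff]; field_simp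
  rw [e, le_div_iff₀ (by positivity), div_le_iff₀ (by positivity)]
  constructor <;> nlinarith

theorem smul_gradEst_eq {n k : ℕ} (f : E n → ℝ) (η δ : ℝ) (v : Fin k → E n) (x : E n) :
    η • gradEst f δ v x = (η * n / k) • ∑ i, centralDiff f δ x (v i) • v i := by
  simp only [gradEst, centralDiff, Finset.smul_sum, smul_smul]
  refine Finset.sum_congr rfl fun i _ => ?_
  congr 1
  ring

theorem LSmooth.norm_smul_gradEst_le {n k : ℕ} {L : ℝ} {f : E n → ℝ} (hf : LSmooth L f)
    {η δ : ℝ} (hη : 0 ≤ η) (hδ : 0 < δ) {v : Fin k → E n} (hv : v ∈ stiefel n k) (x : E n) :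
    ‖η • gradEst f δ v x‖ ≤ η * n / k * (k * (‖gradient f x‖ + L * δ / 2)) := by
  rw [smul_gradEst_eq, norm_smul, Real.norm_of_nonneg (by positivity)]
  gcongr
  refine (norm_sum_le _ _).trans ?_
  have : ∀ i ∈ Finset.univ, ‖centralDiff f δ x (v i) • v i‖ ≤ ‖gradient f x‖ + L * δ / 2 := by
    intro i _
    rw [norm_smul, hv.1 i, mul_one, Real.norm_eq_abs]
    have h1 := hf.abs_centralDiff_sub_le hδ x (hv.1 i)
    have h2 : |inner ℝ (gradient f x) (v i)| ≤ ‖gradient f x‖ := by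
      simpa [hv.1 i] using abs_real_inner_le_norm (gradient f x) (v i)
    rw [abs_le] at *
    constructor <;> linarith
  simpa [mul_add] using Finset.sum_le_sum this

/-- Up to an error of order `δ²`, one step decreases `f` proportionally to the squared norm of the
projected gradient. -/
theorem LSmooth.exists_descent {n k : ℕ} {L η : ℝ} {f : E n → ℝ} (hf : LSmooth L f)
    (hL : 0 < L) (hk : 0 < k) (hn : 0 < n) (hη : 0 < η) (hη' : η < 2 * k / (L * n)) :
    ∃ c > 0, ∃ C > 0, ∀ δ > 0, ∀ v ∈ stiefel n k, ∀ x : E n,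
      f (x - η • gradEst f δ v x) ≤ f x - c * frameSq v (gradient f x) + C * δ ^ 2 := by
  have hk' : (0 : ℝ) < k := by exact_mod_cast hk
  have hn' : (0 : ℝ) < n := by exact_mod_cast hn
  set h : ℝ := η * n / k with hh
  have hh0 : 0 < h := by positivity
  have hhL : L * h < 2 := by
    rw [lt_div_iff₀ (by positivity)] at hη'
    rw [hh, ← mul_div_assoc, div_lt_iff₀ hk']
    linarith
  -- The decrease that exact directional derivatives would give. Half of it is kept; the other half
  -- absorbs the cross terms with the finite-difference error `ε`.
  set c : ℝ := h - L * h ^ 2 / 2 with hc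
  have hc0 : 0 < c := by nlinarith
  set B : ℝ := h ^ 2 / (2 * c) + L * h ^ 2 / 2 with hB
  have hB0 : 0 < B := by positivity
  refine ⟨c / 2, by positivity, B * (L / 2) ^ 2 * k, by positivity, fun δ hδ v hv x => ?_⟩
  set d : Fin k → ℝ := fun i => centralDiff f δ x (v i)
  set γ : Fin k → ℝ := fun i => inner ℝ (gradient f x) (v i)
  have hstep : x - η • gradEst f δ v x = x + -(h • ∑ i, d i • v i) := by
    rw [smul_gradEst_eq, sub_eq_add_neg]
  have hin : inner ℝ (gradient f x) (-(h • ∑ i, d i • v i)) = - (h * ∑ i, d i * γ i) := by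
    simp [inner_neg_right, inner_smul_right, inner_sum, γ]
  have hno : ‖-(h • ∑ i, d i • v i)‖ ^ 2 = h ^ 2 * ∑ i, d i ^ 2 := by
    rw [norm_neg, norm_smul, mul_pow, Real.norm_of_nonneg hh0.le,
      ← real_inner_self_eq_norm_sq (∑ i, d i • v i), Orthonormal.inner_sum hv]
    simp [sq]
  have hdesc := hf.abs_sub_sub_inner_le x (-(h • ∑ i, d i • v i))
  rw [hin, hno, abs_le] at hdesc
  have hterm : ∀ i, -(h * (d i * γ i)) + L / 2 * (h ^ 2 * d i ^ 2)
      ≤ - (c / 2) * γ i ^ 2 + B * (L * δ / 2) ^ 2 := by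
    intro i
    obtain ⟨ε, hε⟩ : ∃ ε, d i = γ i + ε := ⟨d i - γ i, by ring⟩
    have hεb : ε ^ 2 ≤ (L * δ / 2) ^ 2 := by
      have := hf.abs_centralDiff_sub_le hδ x (hv.1 i)
      change |d i - γ i| ≤ _ at this
      rw [hε, add_sub_cancel_left] at this
      exact sq_le_sq' (abs_le.1 this).1 (abs_le.1 this).2
    -- Young's inequality with weight `c`, where `|L h² - h| ≤ h` because `0 < L h < 2`.
    have hcross : (L * h ^ 2 - h) * (γ i * ε) ≤ c / 2 * γ i ^ 2 + h ^ 2 / (2 * c) * ε ^ 2 := by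
      have hsq : (L * h ^ 2 - h) ^ 2 ≤ h ^ 2 := by
        apply sq_le_sq'
        · nlinarith
        · nlinarith
      have h0 := sq_nonneg (c * γ i - (L * h ^ 2 - h) * ε)
      have h1 : (L * h ^ 2 - h) * (γ i * ε)
          ≤ c / 2 * γ i ^ 2 + (L * h ^ 2 - h) ^ 2 / (2 * c) * ε ^ 2 := by
        have : c / 2 * γ i ^ 2 + (L * h ^ 2 - h) ^ 2 / (2 * c) * ε ^ 2
            - (L * h ^ 2 - h) * (γ i * ε) = (c * γ i - (L * h ^ 2 - h) * ε) ^ 2 / (2 * c) := by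
          field_simp; ring
        have : 0 ≤ (c * γ i - (L * h ^ 2 - h) * ε) ^ 2 / (2 * c) := by positivity
        linarith
      refine h1.trans ?_
      gcongr
    have hBε : B * ε ^ 2 ≤ B * (L * δ / 2) ^ 2 := by gcongr
    rw [hε]
    have e : -(h * ((γ i + ε) * γ i)) + L / 2 * (h ^ 2 * (γ i + ε) ^ 2)
        = - c * γ i ^ 2 + (L * h ^ 2 - h) * (γ i * ε) + L * h ^ 2 / 2 * ε ^ 2 := by
      rw [hc]; ring
    have e2 : B * ε ^ 2 = h ^ 2 / (2 * c) * ε ^ 2 + L * h ^ 2 / 2 * ε ^ 2 := by rw [hB]; ring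
    linarith
  have hsum := Finset.sum_le_sum fun i (_ : i ∈ Finset.univ) => hterm i
  simp only [Finset.sum_add_distrib, Finset.sum_neg_distrib, ← Finset.mul_sum, Finset.sum_const,
    Finset.card_univ, Fintype.card_fin, nsmul_eq_mul] at hsum
  rw [hstep]
  have hfr : frameSq v (gradient f x) = ∑ i, γ i ^ 2 := rfl
  rw [hfr]
  nlinarith [hdesc.2]

/-! ### Scalar recursions -/

/-- `a` is the excess energy of a sequence of values `φ` converging to `ℓ`: it is positive,
comparable to `φ - ℓ` up to an exponentially small error, and decreases by at least `c p G²`,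
where `G` is the gradient norm and `p` the squared projection ratio. -/
structure IsExcess (c D : ℝ) (p G φ : ℕ → ℝ) (ℓ : ℝ) (a : ℕ → ℝ) : Prop where
  descent : ∀ t, a (t + 1) + c * (p t * G t ^ 2) + D / 4 / 4 ^ t ≤ a t
  pos : ∀ t, 0 < a t
  le_abs_add : ∀ t, a t ≤ |φ t - ℓ| + D / 4 ^ t
  abs_le : ∀ t, |φ t - ℓ| ≤ 5 * a t

/-- The term `D / 4 ^ t` drops by three quarters of itself per step: two thirds of the drop pay for
the error and `D / 4 / 4 ^ t` stays in reserve. The reserve makes `a` strictly positive and gives `D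
/ 4 ^ t ≤ 4 * a t`, whence the factor `5`. The bound on `a 0` does not involve `ℓ`, so along random
paths it is deterministic. -/
theorem exists_isExcess {c D m : ℝ} (hc : 0 < c) (hD : 0 < D) {p G φ : ℕ → ℝ}
    (hp : ∀ t, 0 ≤ p t) (hm : ∀ t, m ≤ φ t)
    (h : ∀ t, φ (t + 1) ≤ φ t - c * (p t * G t ^ 2) + D / 2 / 4 ^ t) :
    ∃ ℓ a, Tendsto φ atTop (𝓝 ℓ) ∧ IsExcess c D p G φ ℓ a ∧ a 0 ≤ φ 0 + D - m := by
  set F : ℕ → ℝ := fun t => φ t + D / 4 ^ t with hF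
  have hstep : ∀ t, F (t + 1) + c * (p t * G t ^ 2) + D / 4 / 4 ^ t ≤ F t := by
    intro t
    have e : D / (4 : ℝ) ^ (t + 1) = D / 4 ^ t / 4 := by rw [pow_succ]; field_simp
    have e1 : D / 2 / (4 : ℝ) ^ t = D / 4 ^ t / 2 := by ring
    have e2 : D / 4 / (4 : ℝ) ^ t = D / 4 ^ t / 4 := by ring
    have := h t
    simp only [hF]
    rw [e, e2]
    rw [e1] at this
    linarith
  have hpos : ∀ t : ℕ, 0 < D / 4 / (4 : ℝ) ^ t := fun t => by positivity
  have hdec : ∀ t, 0 ≤ c * (p t * G t ^ 2) := fun t =>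
    mul_nonneg hc.le (mul_nonneg (hp t) (sq_nonneg _))
  have hanti : Antitone F := antitone_nat_of_succ_le fun t => by
    linarith [hstep t, hpos t, hdec t]
  have hFm : ∀ t, m ≤ F t := fun t => by
    have : 0 < D / (4 : ℝ) ^ t := by positivity
    have := hm t
    simp only [hF]; linarith
  have hbdd : BddBelow (Set.range F) := ⟨m, by rintro _ ⟨t, rfl⟩; exact hFm t⟩
  have hlim := tendsto_atTop_ciInf hanti hbdd
  set ℓ := ⨅ t, F t
  have hle : ∀ t, ℓ ≤ F t := fun t => ciInf_le hbdd t
  have hD0 : Tendsto (fun t : ℕ => D / (4 : ℝ) ^ t) atTop (𝓝 0) :=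
    tendsto_const_nhds.div_atTop (tendsto_pow_atTop_atTop_of_one_lt (by norm_num))
  have hlow : ∀ t, D / 4 / 4 ^ t ≤ F t - ℓ := fun t => by
    linarith [hstep t, hdec t, hle (t + 1)]
  refine ⟨ℓ, fun t => F t - ℓ, ?_, ⟨fun t => ?_, fun t => ?_, fun t => ?_, fun t => ?_⟩, ?_⟩
  · simpa [hF] using hlim.sub hD0
  · linarith [hstep t]
  · linarith [hlow t, hpos t]
  · have := le_abs_self (φ t - ℓ)
    simp only [hF]; linarith
  · have h1 := hlow t
    have e2 : D / 4 / (4 : ℝ) ^ t = D / 4 ^ t / 4 := by ring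
    have h2 := hpos t
    rw [e2] at h1 h2
    simp only [hF] at h1 ⊢
    rw [_root_.abs_le]
    constructor <;> linarith
  · have : m ≤ ℓ := le_ciInf hFm
    simp [hF]; linarith

variable {c D κ θ ℓ : ℝ} {p G φ a : ℕ → ℝ}

theorem IsExcess.le_self (h : IsExcess c D p G φ ℓ a) (hD : 0 < D) (t : ℕ) :
    c * (p t * G t ^ 2) ≤ a t - a (t + 1) := by
  have : 0 < D / 4 / (4 : ℝ) ^ t := by positivity
  linarith [h.descent t]

theorem IsExcess.sum_le (h : IsExcess c D p G φ ℓ a) (hD : 0 < D) (t : ℕ) :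
    ∑ s ∈ Finset.range t, c * (p s * G s ^ 2) ≤ a 0 := by
  have h1 := Finset.sum_le_sum fun s (_ : s ∈ Finset.range t) => h.le_self hD s
  rw [Finset.sum_range_sub'] at h1
  linarith [h.pos t]

/-- Subadditivity of `s ↦ s ^ θ`. Since `1/2 ≤ θ`, the error is at most of order `2 ^ (-t)`, which
is summable. -/
theorem IsExcess.eventually_rpow_le (h : IsExcess c D p G φ ℓ a) (hD : 0 < D)
    (hθ : 1 / 2 ≤ θ) (hθ' : θ < 1) (hloj : ∀ᶠ t in atTop, |φ t - ℓ| ^ θ ≤ κ * G t) :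
    ∀ᶠ t : ℕ in atTop, a t ^ θ ≤ κ * G t + √(D / 4 ^ t) := by
  have hD0 : Tendsto (fun t : ℕ => D / (4 : ℝ) ^ t) atTop (𝓝 0) :=
    tendsto_const_nhds.div_atTop (tendsto_pow_atTop_atTop_of_one_lt (by norm_num))
  filter_upwards [hloj, hD0.eventually_lt_const one_pos] with t ht hv
  have hv0 : 0 < D / (4 : ℝ) ^ t := by positivity
  calc a t ^ θ ≤ (|φ t - ℓ| + D / 4 ^ t) ^ θ :=
        Real.rpow_le_rpow (h.pos t).le (h.le_abs_add t) (by linarith)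
    _ ≤ |φ t - ℓ| ^ θ + (D / 4 ^ t) ^ θ :=
        Real.rpow_add_le_add_rpow (abs_nonneg _) hv0.le (by linarith) hθ'.le
    _ ≤ κ * G t + √(D / 4 ^ t) := by
        refine add_le_add ht ?_
        rw [Real.sqrt_eq_rpow]
        exact Real.rpow_le_rpow_of_exponent_ge hv0 hv.le hθ

/-- Łojasiewicz's length argument: by concavity, `a ^ (1 - θ)` drops by at least `(1 - θ) * a ^
(-θ)` times the drop of `a`, which is at least `c p G²`; and `a ^ θ` is at most a multiple of `G`.
So `p G` is bounded by a telescoping term. -/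
theorem IsExcess.summable_mul (h : IsExcess c D p G φ ℓ a) (hc : 0 < c) (hD : 0 < D)
    (hκ : 0 < κ) (hp : ∀ t, 0 ≤ p t) (hp1 : ∀ t, p t ≤ 1) (hG : ∀ t, 0 ≤ G t)
    (hθ : 1 / 2 ≤ θ) (hθ' : θ < 1) (hloj : ∀ᶠ t in atTop, |φ t - ℓ| ^ θ ≤ κ * G t) :
    Summable fun t => p t * G t := by
  have hsq : ∀ t : ℕ, √(D / 4 ^ t) = √D * (1 / 2) ^ t := fun t => by
    rw [show D / (4 : ℝ) ^ t = D * ((1 / 2) ^ t) ^ 2 by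
      rw [← pow_mul, mul_comm t 2, pow_mul, div_eq_mul_inv, ← inv_pow]; norm_num, Real.sqrt_mul hD.le,
      Real.sqrt_sq (by positivity)]
  set K := (κ + 1) / c / (1 - θ)
  have h1θ : 0 < 1 - θ := by linarith
  have hK : 0 < K := by positivity
  have hkey : ∀ᶠ t in atTop, p t * G t
      ≤ K * (a t ^ (1 - θ) - a (t + 1) ^ (1 - θ)) + √D * (1 / 2) ^ t := by
    filter_upwards [h.eventually_rpow_le hD hθ hθ' hloj] with t ht
    rw [hsq] at ht
    have hle : a (t + 1) ≤ a t := by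
      have := h.le_self hD t
      have : 0 ≤ c * (p t * G t ^ 2) := mul_nonneg hc.le (mul_nonneg (hp t) (sq_nonneg _))
      linarith
    have hmono : 0 ≤ a t ^ (1 - θ) - a (t + 1) ^ (1 - θ) := by
      have := Real.rpow_le_rpow (h.pos (t + 1)).le hle h1θ.le
      linarith
    have hb : 0 ≤ √D * (1 / 2) ^ t := by positivity
    -- If the gradient dominates the granularity error, that error is absorbed into `(κ + 1) * G t`;
    -- otherwise `p t * G t` is itself below a geometric term.
    rcases le_total (√D * (1 / 2) ^ t) (G t) with hcase | hcase
    · have hat := h.pos t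
      have hat' := h.pos (t + 1)
      have hbern : a t ^ θ * (a t ^ (1 - θ) - a (t + 1) ^ (1 - θ)) ≥ (1 - θ) * (a t - a (t + 1)) := by
        have h1 := rpow_one_add_le_one_add_mul_self (s := a (t + 1) / a t - 1)
          (by have : 0 < a (t + 1) / a t := by positivity
              linarith) h1θ.le (by linarith : 1 - θ ≤ 1)
        rw [add_sub_cancel, Real.div_rpow hat'.le hat.le, div_le_iff₀ (by positivity)] at h1
        have h2 : a t ^ θ * a t ^ (1 - θ) = a t := by
          rw [← Real.rpow_add hat]; simp
        have h3 := mul_le_mul_of_nonneg_left h1 (Real.rpow_nonneg hat.le θ)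
        have h4 : a t ^ θ * ((1 + (1 - θ) * (a (t + 1) / a t - 1)) * a t ^ (1 - θ))
            = a t - (1 - θ) * (a t - a (t + 1)) := by
          rw [mul_left_comm, h2]
          field_simp
          ring
        rw [h4] at h3
        rw [mul_sub, h2]
        linarith
      have hθG : a t ^ θ ≤ (κ + 1) * G t := by linarith
      have hapos : 0 < a t ^ θ := Real.rpow_pos_of_pos hat θ
      have : p t * G t * a t ^ θ
          ≤ K * (a t ^ (1 - θ) - a (t + 1) ^ (1 - θ)) * a t ^ θ := by
        calc p t * G t * a t ^ θ ≤ p t * G t * ((κ + 1) * G t) :=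
              mul_le_mul_of_nonneg_left hθG (mul_nonneg (hp t) (hG t))
          _ = (κ + 1) / c * (c * (p t * G t ^ 2)) := by field_simp
          _ ≤ (κ + 1) / c * (a t - a (t + 1)) := by gcongr; exact h.le_self hD t
          _ = K * ((1 - θ) * (a t - a (t + 1))) := by simp only [K]; field_simp
          _ ≤ K * (a t ^ θ * (a t ^ (1 - θ) - a (t + 1) ^ (1 - θ))) := by gcongr
          _ = _ := by ring
      have := le_of_mul_le_mul_right this hapos
      linarith
    · have : p t * G t ≤ G t := mul_le_of_le_one_left (hG t) (hp1 t)
      have := mul_nonneg hK.le hmono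
      linarith
  obtain ⟨T, hT⟩ := eventually_atTop.1 hkey
  rw [← summable_nat_add_iff T]
  have hgeo : Summable fun t : ℕ => √D * (1 / 2 : ℝ) ^ (t + T) := by
    have := (summable_geometric_two).mul_left (√D)
    exact (summable_nat_add_iff T (f := fun t : ℕ => √D * (1 / 2 : ℝ) ^ t)).2 this
  refine summable_of_sum_range_le (c := K * a T ^ (1 - θ) + ∑' t : ℕ, √D * (1 / 2 : ℝ) ^ (t + T))
    (fun t => mul_nonneg (hp _) (hG _)) fun N => ?_
  have h1 := Finset.sum_le_sum fun s (_ : s ∈ Finset.range N) => hT (s + T) (Nat.le_add_left _ _)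
  rw [Finset.sum_add_distrib, ← Finset.mul_sum] at h1
  have h2 := Finset.sum_range_sub' (fun s => a (s + T) ^ (1 - θ)) N
  have h3 : ∀ s, a (s + T + 1) = a (s + 1 + T) := fun s => by congr 1; ring
  simp only [h3] at h1
  rw [h2] at h1
  have h4 := hgeo.sum_le_tsum (Finset.range N) (fun _ _ => by positivity)
  have h5 := Real.rpow_nonneg (h.pos (N + T)).le (1 - θ)
  have h6 := mul_nonneg hK.le h5
  simp only [zero_add] at h1
  linarith

/-- The contraction factor attached to a descent constant `c` and a Łojasiewicz constant `κ`. -/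
noncomputable def contraction (c κ : ℝ) : ℝ := 1 / (2 * κ ^ 2 / c + 8)

theorem contraction_pos (hc : 0 < c) : 0 < contraction c κ := by
  unfold contraction; positivity

theorem contraction_le (hc : 0 < c) : contraction c κ ≤ 1 / 2 := by
  unfold contraction
  have : 0 ≤ 2 * κ ^ 2 / c := by positivity
  exact one_div_le_one_div_of_le (by norm_num) (by linarith)

/-- Square the Łojasiewicz bound and charge both terms to the drop of `a`: `2κ² p G²` costs `2κ² /
c` drops, and `2D / 4 ^ t` costs `8` by the reserve `D / 4 / 4 ^ t` in the descent inequality. -/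
theorem IsExcess.eventually_le_sub (h : IsExcess c D p G φ ℓ a) (hc : 0 < c) (hD : 0 < D)
    (hκ : 0 < κ) (hp : ∀ t, 0 ≤ p t) (hp1 : ∀ t, p t ≤ 1)
    (hθ : 1 / 2 ≤ θ) (hθ' : θ < 1) (hloj : ∀ᶠ t in atTop, |φ t - ℓ| ^ θ ≤ κ * G t) :
    ∀ᶠ t in atTop, a (t + 1) ≤ a t - contraction c κ * p t * a t ^ (2 * θ) := by
  filter_upwards [h.eventually_rpow_le hD hθ hθ' hloj] with t ht
  have hat := h.pos t
  have hv0 : 0 < D / (4 : ℝ) ^ t := by positivity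
  have h1 : a t ^ (2 * θ) ≤ 2 * κ ^ 2 * G t ^ 2 + 2 * (D / 4 ^ t) := by
    have e : a t ^ (2 * θ) = (a t ^ θ) ^ 2 := by
      rw [mul_comm, Real.rpow_mul hat.le, Real.rpow_two]
    rw [e]
    have h2 : (a t ^ θ) ^ 2 ≤ (κ * G t + √(D / 4 ^ t)) ^ 2 :=
      pow_le_pow_left₀ (Real.rpow_nonneg hat.le θ) ht 2
    have h3 := Real.sq_sqrt hv0.le
    nlinarith [sq_nonneg (κ * G t - √(D / 4 ^ t))]
  have h2 : p t * a t ^ (2 * θ) ≤ (2 * κ ^ 2 / c + 8) * (a t - a (t + 1)) := by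
    have hd := h.descent t
    have e : D / 4 / (4 : ℝ) ^ t = D / 4 ^ t / 4 := by ring
    rw [e] at hd
    have h0 : 0 ≤ c * (p t * G t ^ 2) := mul_nonneg hc.le (mul_nonneg (hp t) (sq_nonneg _))
    calc p t * a t ^ (2 * θ) ≤ p t * (2 * κ ^ 2 * G t ^ 2 + 2 * (D / 4 ^ t)) :=
          mul_le_mul_of_nonneg_left h1 (hp t)
      _ ≤ 2 * κ ^ 2 / c * (c * (p t * G t ^ 2)) + 2 * (D / 4 ^ t) := by
          have : p t * (2 * (D / 4 ^ t)) ≤ 2 * (D / 4 ^ t) :=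
            mul_le_of_le_one_left (by positivity) (hp1 t)
          have e2 : 2 * κ ^ 2 / c * (c * (p t * G t ^ 2)) = p t * (2 * κ ^ 2 * G t ^ 2) := by
            field_simp
          rw [e2]; linarith
      _ ≤ 2 * κ ^ 2 / c * (a t - a (t + 1)) + 8 * (a t - a (t + 1)) := by
          have hk0 : 0 ≤ 2 * κ ^ 2 / c := by positivity
          have := mul_le_mul_of_nonneg_left (h.le_self hD t) hk0
          linarith
      _ = _ := by ring
  have hpos : 0 < 2 * κ ^ 2 / c + 8 := by positivity
  have : contraction c κ * p t * a t ^ (2 * θ) ≤ a t - a (t + 1) := by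
    rw [contraction, mul_assoc, one_div, inv_mul_le_iff₀ hpos]
    exact h2
  linarith

theorem exists_forall_le_mul_prod {r : ℝ} (hr : 0 ≤ r) (hr1 : r ≤ 1 / 2)
    (hp1 : ∀ t, p t ≤ 1) (h : ∀ᶠ t in atTop, a (t + 1) ≤ a t - r * p t * a t) :
    ∃ B, ∀ᶠ t in atTop, a t ≤ B * ∏ s ∈ Finset.range t, (1 - r * p s) := by
  have hpos : ∀ s, 0 < 1 - r * p s := fun s => by nlinarith [hp1 s]
  have hW : ∀ t, 0 < ∏ s ∈ Finset.range t, (1 - r * p s) := fun t =>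
    Finset.prod_pos fun s _ => hpos s
  obtain ⟨T, hT⟩ := eventually_atTop.1 h
  refine ⟨a T / ∏ s ∈ Finset.range T, (1 - r * p s), eventually_atTop.2 ⟨T, fun t ht => ?_⟩⟩
  induction t, ht using Nat.le_induction with
  | base => rw [div_mul_cancel₀ _ (hW T).ne']
  | succ t ht ih =>
    rw [Finset.prod_range_succ, ← mul_assoc]
    calc a (t + 1) ≤ a t * (1 - r * p t) := by linarith [hT t ht]
      _ ≤ _ := mul_le_mul_of_nonneg_right ih (hpos t).le

/-- If `p` has a positive lower density, a sequence with `a' ≤ a - r p a^(1+β)` is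
`O(t^(-1/β))`. -/
theorem isBigO_rpow_of_le_sub {r β d : ℝ} (hr : 0 < r) (hβ : 0 < β) (hβ1 : β ≤ 1)
    (ha : ∀ t, 0 < a t)
    (h : ∀ᶠ t in atTop, a (t + 1) ≤ a t - r * p t * a t ^ (1 + β)) (hd : 0 < d)
    (hsum : ∀ᶠ t : ℕ in atTop, d * t ≤ ∑ s ∈ Finset.range t, p s) :
    a =O[atTop] fun t : ℕ => (t : ℝ) ^ (-(1 / β)) := by
  obtain ⟨T, hT⟩ := eventually_atTop.1 h
  set S : ℕ → ℝ := fun t => ∑ s ∈ Finset.range t, p s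
  -- Discrete form of `(a ^ (-β))' ≥ β r p`. Bernoulli's inequality for the exponent `β ≤ 1` bounds
  -- the ratio of consecutive `a ^ β` by `1 - y`, and `1 / (1 - y) ≥ 1 + y`.
  have hgrow : ∀ t ≥ T, β * r * (S t - S T) ≤ a t ^ (-β) := by
    intro t ht
    induction t, ht using Nat.le_induction with
    | base => simpa using Real.rpow_nonneg (ha T).le _
    | succ t ht ih =>
      have hat := ha t
      have hat' := ha (t + 1)
      have hS : S (t + 1) = S t + p t := Finset.sum_range_succ _ _
      have hpw : a t ^ (1 + β) = a t * a t ^ β := by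
        rw [Real.rpow_add hat, Real.rpow_one]
      have hratio : a (t + 1) / a t - 1 ≤ - (r * p t * a t ^ β) := by
        rw [sub_le_iff_le_add, div_le_iff₀ hat]
        have := hT t ht
        rw [hpw] at this
        linarith
      have hbern := rpow_one_add_le_one_add_mul_self (s := a (t + 1) / a t - 1)
          (by have : 0 < a (t + 1) / a t := by positivity
              linarith) hβ.le hβ1
      rw [add_sub_cancel, Real.div_rpow hat'.le hat.le] at hbern
      set y := β * (r * p t * a t ^ β) with hy
      have hb2 : a (t + 1) ^ β / a t ^ β ≤ 1 - y := by
        have := mul_le_mul_of_nonneg_left hratio hβ.le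
        rw [hy]; linarith
      have hA := Real.rpow_pos_of_pos hat β
      have hA' := Real.rpow_pos_of_pos hat' β
      have hq : 0 < a (t + 1) ^ β / a t ^ β := by positivity
      have hinv : 1 + y ≤ a t ^ β / a (t + 1) ^ β := by
        have h1 : a t ^ β / a (t + 1) ^ β = (a (t + 1) ^ β / a t ^ β)⁻¹ := by rw [inv_div]
        have h2 : 1 + y ≤ (1 - y)⁻¹ := by
          rw [← one_div, le_div_iff₀ (by linarith)]
          nlinarith [sq_nonneg y]
        rw [h1]
        exact h2.trans (inv_anti₀ hq hb2)
      rw [le_div_iff₀ hA'] at hinv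
      rw [Real.rpow_neg hat.le] at ih
      rw [Real.rpow_neg hat'.le, hS]
      have h3 : (a t ^ β)⁻¹ + β * r * p t ≤ (a (t + 1) ^ β)⁻¹ := by
        rw [← one_div, ← one_div, le_div_iff₀ hA']
        have : (1 / a t ^ β + β * r * p t) * a (t + 1) ^ β
            = (1 + y) * a (t + 1) ^ β / a t ^ β := by
          rw [hy]; field_simp
        rw [this, div_le_one hA]
        exact hinv
      linarith
  -- Half of the density `d` compensates the initial sum `S T`.
  have hev : ∀ᶠ t : ℕ in atTop, β * r * d / 2 * t ≤ a t ^ (-β) := by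
    have h1 : ∀ᶠ t : ℕ in atTop, 2 * S T / d ≤ (t : ℝ) :=
      tendsto_natCast_atTop_atTop.eventually_ge_atTop _
    filter_upwards [hsum, h1, eventually_ge_atTop T] with t ht ht1 htT
    refine le_trans ?_ (hgrow t htT)
    rw [div_le_iff₀ hd] at ht1
    have : d / 2 * t ≤ S t - S T := by linarith
    have := mul_le_mul_of_nonneg_left this (mul_pos hβ hr).le
    linarith
  set q := β * r * d / 2
  have hq : 0 < q := by positivity
  refine IsBigO.of_bound (q ^ (-(1 / β))) ?_
  filter_upwards [hev, eventually_gt_atTop 0] with t ht ht0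
  have ht0' : (0 : ℝ) < t := by exact_mod_cast ht0
  rw [Real.norm_of_nonneg (ha t).le, Real.norm_of_nonneg (by positivity),
    ← Real.mul_rpow hq.le ht0'.le]
  have h1 := Real.rpow_le_rpow_of_nonpos (by positivity : 0 < q * t) ht
    (by have : 0 < 1 / β := by positivity
        linarith : -(1 / β) ≤ 0)
  rwa [← Real.rpow_mul (ha t).le, neg_mul_neg, mul_one_div_cancel hβ.ne', Real.rpow_one] at h1

/-- Exponential decay of `∏ (1 - p / 2)` forces a positive lower density of `p`. -/
theorem exists_density_of_prod_tendsto (hp : ∀ t, 0 ≤ p t) (hp1 : ∀ t, p t ≤ 1) {Q : ℝ}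
    (hQ : 1 < Q)
    (h : Tendsto (fun t : ℕ => Q ^ t * ∏ s ∈ Finset.range t, (1 - 1 / 2 * p s)) atTop (𝓝 0)) :
    ∃ d > 0, ∀ᶠ t : ℕ in atTop, d * t ≤ ∑ s ∈ Finset.range t, p s := by
  refine ⟨Real.log Q / Real.log 2, div_pos (Real.log_pos hQ) (Real.log_pos one_lt_two), ?_⟩
  filter_upwards [h.eventually_lt_const one_pos] with t ht
  have hQ0 : 0 < Q := by linarith
  -- By convexity `2 ^ (-s)` lies below its chord `1 - s / 2` on `[0, 1]`.
  have h1 : (1 / 2 : ℝ) ^ (∑ s ∈ Finset.range t, p s)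
      ≤ ∏ s ∈ Finset.range t, (1 - 1 / 2 * p s) := by
    rw [Real.rpow_sum_of_pos (by norm_num)]
    refine Finset.prod_le_prod (fun s _ => by positivity) fun s _ => ?_
    have := rpow_one_add_le_one_add_mul_self (s := -(1 / 2)) (by norm_num) (hp s) (hp1 s)
    norm_num at this ⊢
    linarith
  have h2 : Q ^ t * (1 / 2 : ℝ) ^ (∑ s ∈ Finset.range t, p s) ≤ 1 :=
    (mul_le_mul_of_nonneg_left h1 (by positivity)).trans ht.le
  have h3 := Real.log_nonpos (by positivity) h2
  rw [Real.log_mul (by positivity) (by positivity), Real.log_pow, Real.log_rpow (by norm_num),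
    one_div, Real.log_inv] at h3
  rw [div_mul_eq_mul_div, div_le_iff₀ (Real.log_pos one_lt_two)]
  linarith

/-! ### Random projections -/

theorem frameSq_map {n k : ℕ} (U : E n ≃ₗᵢ[ℝ] E n) (v : Fin k → E n) (u : E n) :
    frameSq (fun i => U (v i)) (U u) = frameSq v u := by
  simp [frameSq]

theorem measurable_frameSq_left {n k : ℕ} (u : E n) :
    Measurable fun v : Fin k → E n => frameSq v u :=
  measurable_frameSq measurable_id measurable_const

/-- A uniformly distributed `k`-frame captures the fraction `k / n` of the squared norm of a fixed
vector, in mean. -/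
theorem IsStiefelUniform.lintegral_frameSq {n k : ℕ} (hn : 0 < n) {ν : Measure (Fin k → E n)}
    (hν : IsStiefelUniform ν) {u : E n} (hu : ‖u‖ = 1) :
    ∫⁻ v, ENNReal.ofReal (frameSq v u) ∂ν = ENNReal.ofReal (k / n) := by
  have := hν.isProbabilityMeasure
  -- A reflection carries `u` to `w`, so by invariance all unit vectors have the same mean. Over an
  -- orthonormal basis these means add up to `k`, by Parseval for each column.
  have hinv : ∀ w : E n, ‖w‖ = 1 →
      ∫⁻ v, ENNReal.ofReal (frameSq v w) ∂ν = ∫⁻ v, ENNReal.ofReal (frameSq v u) ∂ν := by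
    intro w hw
    set U : E n ≃ₗᵢ[ℝ] E n := (Submodule.span ℝ {u - w})ᗮ.reflection
    have hU : U u = w := Submodule.reflection_sub (hu.trans hw.symm)
    have hm : Measurable fun (v : Fin k → E n) i => U (v i) := by fun_prop
    conv_lhs => rw [← hν.invariant U]
    rw [lintegral_map ((measurable_frameSq_left w).ennreal_ofReal) hm, ← hU]
    simp_rw [frameSq_map]
  set I := ∫⁻ v, ENNReal.ofReal (frameSq v u) ∂ν
  set b := EuclideanSpace.basisFun (Fin n) ℝ
  have hsum : ∫⁻ v, ∑ j, ENNReal.ofReal (frameSq v (b j)) ∂ν = n * I := by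
    rw [lintegral_finsetSum _ fun j _ => (measurable_frameSq_left (b j)).ennreal_ofReal]
    simp [hinv _ (b.norm_eq_one _)]
  have hone : ∫⁻ v, ∑ j, ENNReal.ofReal (frameSq v (b j)) ∂ν = k := by
    have : ∀ᵐ v ∂ν, ∑ j, ENNReal.ofReal (frameSq v (b j)) = k := by
      filter_upwards [hν.ae_mem] with v hv
      rw [← ENNReal.ofReal_sum_of_nonneg fun _ _ => frameSq_nonneg _ _]
      have h1 : ∑ j, frameSq v (b j) = k := by
        simp only [frameSq]
        rw [Finset.sum_comm]
        have : ∀ i, ∑ j, inner ℝ (b j) (v i) ^ 2 = 1 := fun i => by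
          have := b.sum_sq_norm_inner_right (v i)
          simpa [hv.1 i] using this
        simp [this]
      rw [h1, ENNReal.ofReal_natCast]
    rw [lintegral_congr_ae this]
    simp
  have hnI : (n : ENNReal) * I = k := hsum.symm.trans hone
  have hn0 : (n : ENNReal) ≠ 0 := by exact_mod_cast hn.ne'
  rw [ENNReal.ofReal_div_of_pos (by exact_mod_cast hn), ENNReal.ofReal_natCast,
    ENNReal.ofReal_natCast]
  exact ENNReal.eq_div_iff hn0 (ENNReal.natCast_ne_top n) |>.2 hnI

/-- The `σ`-algebras generated by the frames drawn before time `t`. -/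
def past {n k : ℕ} {Ω : Type*} [MeasurableSpace Ω] {P : Measure Ω} {V : ℕ → Ω → Fin k → E n}
    (hV : IsStiefelSample P V) : Filtration ℕ ‹MeasurableSpace Ω› where
  seq t := ⨆ i ∈ Set.Iio t, MeasurableSpace.comap (V i) inferInstance
  mono' _ _ hst := biSup_mono fun _ hi => lt_of_lt_of_le hi hst
  le' _ := iSup₂_le fun i _ => (hV.measurable i).comap_le

theorem IsStiefelSample.measurable_past {n k : ℕ} {Ω : Type*} [MeasurableSpace Ω] {P : Measure Ω}
    {V : ℕ → Ω → Fin k → E n} (hV : IsStiefelSample P V) (t : ℕ) :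
    Measurable[past hV (t + 1)] (V t) := by
  have h : MeasurableSpace.comap (V t) inferInstance ≤ past hV (t + 1) :=
    le_iSup₂_of_le (f := fun i (_ : i ∈ Set.Iio (t + 1)) =>
      MeasurableSpace.comap (V i) inferInstance) t (Nat.lt_succ_self t) le_rfl
  exact fun s hs => h _ ⟨s, hs, rfl⟩

theorem IsStiefelSample.indepFun {n k : ℕ} {Ω β : Type*} [MeasurableSpace Ω] [MeasurableSpace β]
    {P : Measure Ω} {V : ℕ → Ω → Fin k → E n} (hV : IsStiefelSample P V) {t : ℕ} {X : Ω → β}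
    (hX : Measurable[past hV t] X) : IndepFun X (V t) P := by
  have h := indep_iSup_of_disjoint (fun i => (hV.measurable i).comap_le) hV.indep
    (S := Set.Iio t) (T := {t}) (by simp)
  rw [iSup_singleton] at h
  exact indep_of_indep_of_le_left h hX.comap_le

/-- The pair `(u, Z)` is independent of `V t`, so by Tonelli the frame can be integrated first with
`u` frozen. Testing against all such `Z` expresses that the conditional mean is `k / n`. -/
theorem IsStiefelSample.lintegral_mul_frameSq {n k : ℕ} (hn : 0 < n) {Ω : Type*}
    [MeasurableSpace Ω] {P : Measure Ω} [IsProbabilityMeasure P] {V : ℕ → Ω → Fin k → E n}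
    (hV : IsStiefelSample P V) {t : ℕ} {Z : Ω → ENNReal} {u : Ω → E n}
    (hZ : Measurable[past hV t] Z) (hu : Measurable[past hV t] u) (hu1 : ∀ ω, ‖u ω‖ = 1) :
    ∫⁻ ω, Z ω * ENNReal.ofReal (frameSq (V t ω) (u ω)) ∂P
      = ENNReal.ofReal (k / n) * ∫⁻ ω, Z ω ∂P := by
  have hX : Measurable[past hV t] fun ω => (u ω, Z ω) := hu.prodMk hZ
  have hX' : Measurable fun ω => (u ω, Z ω) := hX.mono ((past hV).le t) le_rfl
  have hZ' : Measurable Z := hZ.mono ((past hV).le t) le_rfl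
  have hind := hV.indepFun hX
  have hprod := (indepFun_iff_map_prod_eq_prod_map_map hX'.aemeasurable
    (hV.measurable t).aemeasurable).1 hind
  have hF : Measurable fun z : (E n × ENNReal) × (Fin k → E n) =>
      z.1.2 * ENNReal.ofReal (frameSq z.2 z.1.1) := by
    refine (measurable_snd.comp measurable_fst).mul (Measurable.ennreal_ofReal ?_)
    exact measurable_frameSq measurable_snd (measurable_fst.comp measurable_fst)
  have hVt := (hV.uniform t).isProbabilityMeasure
  calc ∫⁻ ω, Z ω * ENNReal.ofReal (frameSq (V t ω) (u ω)) ∂P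
      = ∫⁻ z, z.1.2 * ENNReal.ofReal (frameSq z.2 z.1.1)
          ∂(P.map fun ω => ((u ω, Z ω), V t ω)) := by
        rw [lintegral_map hF (hX'.prodMk (hV.measurable t))]
    _ = ∫⁻ y, ∫⁻ v, y.2 * ENNReal.ofReal (frameSq v y.1) ∂(P.map (V t))
          ∂(P.map fun ω => (u ω, Z ω)) := by
        rw [hprod, lintegral_prod _ hF.aemeasurable]
    _ = ∫⁻ ω, ∫⁻ v, Z ω * ENNReal.ofReal (frameSq v (u ω)) ∂(P.map (V t)) ∂P := by
        rw [lintegral_map hF.lintegral_prod_right' hX']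
    _ = ∫⁻ ω, ENNReal.ofReal (k / n) * Z ω ∂P := by
        refine lintegral_congr fun ω => ?_
        rw [lintegral_const_mul _ (measurable_frameSq_left (u ω)).ennreal_ofReal,
          (hV.uniform t).lintegral_frameSq hn (hu1 ω), mul_comm]
    _ = _ := lintegral_const_mul _ hZ'

/-- `w` is an adapted sequence in `[0, 1]` with conditional means `q`. -/
structure IsProjRatio {Ω : Type*} {m : MeasurableSpace Ω} (P : Measure Ω) (𝓕 : Filtration ℕ m)
    (q : ℝ) (w : ℕ → Ω → ℝ) : Prop where
  measurable : ∀ t, Measurable[𝓕 (t + 1)] (w t)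
  nonneg : ∀ᵐ ω ∂P, ∀ t, 0 ≤ w t ω
  le_one : ∀ᵐ ω ∂P, ∀ t, w t ω ≤ 1
  lintegral_mul : ∀ t (Z : Ω → ENNReal), Measurable[𝓕 t] Z →
    ∫⁻ ω, Z ω * ENNReal.ofReal (w t ω) ∂P = ENNReal.ofReal q * ∫⁻ ω, Z ω ∂P

variable {Ω : Type*} {m : MeasurableSpace Ω} {P : Measure Ω} {𝓕 : Filtration ℕ m}
  {q : ℝ} {w : ℕ → Ω → ℝ}

/-- Terms count only while the preceding partial sum is at most `M`, so the overshoot is at most one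
term. -/
theorem sum_indicator_le {x : ℕ → ENNReal} {M M₀ : ENNReal} (hx : ∀ t, x t ≤ M₀) (t : ℕ) :
    ∑ s ∈ Finset.range t, (if ∑ i ∈ Finset.range s, x i ≤ M then x s else 0) ≤ M + M₀ := by
  have h1 : ∀ t, ∑ s ∈ Finset.range t, (if ∑ i ∈ Finset.range s, x i ≤ M then x s else 0)
      ≤ ∑ s ∈ Finset.range t, x s := fun t =>
    Finset.sum_le_sum fun s _ => by split_ifs <;> simp
  induction t with
  | zero => simp
  | succ t ih =>
    rw [Finset.sum_range_succ]
    split_ifs with hc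
    · exact add_le_add ((h1 t).trans hc) (hx t)
    · simpa using ih

/-- Conditional Borel–Cantelli: if `∑ Y w` converges then so does `∑ Y`, almost surely. -/
theorem IsProjRatio.ae_tsum_ne_top [IsProbabilityMeasure P] (hw : IsProjRatio P 𝓕 q w)
    (hq : 0 < q) {Y : ℕ → Ω → ENNReal} (hY : ∀ t, Measurable[𝓕 t] (Y t)) {M₀ : ENNReal}
    (hM₀ : M₀ ≠ ⊤) (hb : ∀ᵐ ω ∂P, ∀ t, Y t ω * ENNReal.ofReal (w t ω) ≤ M₀) :
    ∀ᵐ ω ∂P, ∑' t, Y t ω * ENNReal.ofReal (w t ω) ≠ ⊤ → ∑' t, Y t ω ≠ ⊤ := by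
  set x : ℕ → Ω → ENNReal := fun t ω => Y t ω * ENNReal.ofReal (w t ω) with hx
  have hxm : ∀ t, Measurable[𝓕 (t + 1)] (x t) := fun t =>
    ((hY t).mono (𝓕.mono t.le_succ) le_rfl).mul (hw.measurable t).ennreal_ofReal
  -- `Y` stopped once the partial sums of `Y w` exceed `M`. The test involves only indices below
  -- `t`, so `Z M t` is known at time `t`.
  let Z : ℕ → ℕ → Ω → ENNReal := fun M t ω =>
    if ∑ i ∈ Finset.range t, x i ω ≤ M then Y t ω else 0
  have hZm : ∀ M t, Measurable[𝓕 t] (Z M t) := by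
    intro M t
    have hS : Measurable[𝓕 t] fun ω => ∑ i ∈ Finset.range t, x i ω :=
      Finset.measurable_fun_sum _ fun i hi =>
        (hxm i).mono (𝓕.mono (Finset.mem_range.1 hi)) le_rfl
    exact Measurable.ite (hS measurableSet_Iic) (hY t) measurable_const
  have hZm' : ∀ M t, Measurable (Z M t) := fun M t => (hZm M t).mono (𝓕.le t) le_rfl
  have hfin : ∀ M : ℕ, ∀ᵐ ω ∂P, ∑' t, Z M t ω < ⊤ := by
    intro M
    refine ae_lt_top (Measurable.tsum fun t => hZm' M t) ?_
    have hwm : ∀ t, Measurable (w t) := fun t => (hw.measurable t).mono (𝓕.le _) le_rfl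
    have h1 : ENNReal.ofReal q * ∫⁻ ω, ∑' t, Z M t ω ∂P ≤ M + M₀ := by
      rw [lintegral_tsum fun t => (hZm' M t).aemeasurable, ← ENNReal.tsum_mul_left]
      simp_rw [← hw.lintegral_mul _ _ (hZm M _)]
      have hZw : ∀ t, Measurable fun ω => Z M t ω * ENNReal.ofReal (w t ω) := fun t =>
        (hZm' M t).mul (hwm t).ennreal_ofReal
      rw [← lintegral_tsum fun t => (hZw t).aemeasurable]
      calc ∫⁻ ω, ∑' t, Z M t ω * ENNReal.ofReal (w t ω) ∂P ≤ ∫⁻ _, M + M₀ ∂P := by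
            refine lintegral_mono_ae ?_
            filter_upwards [hb] with ω hω
            refine ENNReal.tsum_le_of_sum_range_le fun t => ?_
            refine le_trans (le_of_eq ?_) (sum_indicator_le (M := M) hω t)
            refine Finset.sum_congr rfl fun s _ => ?_
            simp only [Z, x, ite_mul, zero_mul]
        _ = M + M₀ := by simp
    intro htop
    rw [htop, ENNReal.mul_top (by simpa using hq), top_le_iff] at h1
    exact ENNReal.add_ne_top.2 ⟨ENNReal.natCast_ne_top M, hM₀⟩ h1
  filter_upwards [ae_all_iff.2 hfin] with ω hω hsum
  obtain ⟨M, hM⟩ := ENNReal.exists_nat_gt hsum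
  -- If the whole sum stays below `M`, stopping never occurs.
  have : ∀ t, Z M t ω = Y t ω := fun t =>
    if_pos ((ENNReal.sum_le_tsum (f := fun i => x i ω) _).trans hM.le)
  simpa [this] using (hω M).ne

/-- Each factor has conditional mean `1 - r q`, so the product has mean `(1 - r q) ^ t`. The means
of `Q ^ t * W t` are then summable, so the series itself converges almost surely. -/
theorem IsProjRatio.ae_tendsto_prod [IsProbabilityMeasure P] (hw : IsProjRatio P 𝓕 q w)
    (hq : 0 ≤ q) (hq1 : q ≤ 1) {r Q : ℝ} (hr : 0 ≤ r) (hr1 : r ≤ 1) (hQ : 0 ≤ Q)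
    (hQ1 : Q * (1 - r * q) < 1) :
    ∀ᵐ ω ∂P, Tendsto (fun t : ℕ => Q ^ t * ∏ s ∈ Finset.range t, (1 - r * w s ω)) atTop (𝓝 0) := by
  set W : ℕ → Ω → ℝ := fun t ω => ∏ s ∈ Finset.range t, (1 - r * w s ω) with hW
  have hWm : ∀ t, Measurable[𝓕 t] (W t) := fun t =>
    Finset.measurable_fun_prod _ fun s hs =>
      ((((hw.measurable s).mono (𝓕.mono (Finset.mem_range.1 hs)) le_rfl).const_mul r).const_sub 1)
  have hWm' : ∀ t, Measurable (W t) := fun t => (hWm t).mono (𝓕.le t) le_rfl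
  have hwm : ∀ t, Measurable (w t) := fun t => (hw.measurable t).mono (𝓕.le _) le_rfl
  have hW0 : ∀ᵐ ω ∂P, ∀ t, 0 ≤ W t ω := by
    filter_upwards [hw.nonneg, hw.le_one] with ω h0 h1 t
    refine Finset.prod_nonneg fun s _ => ?_
    nlinarith [h0 s, h1 s]
  have hrq : r * q ≤ 1 := mul_le_one₀ hr1 hq hq1
  have hI : ∀ t, ∫⁻ ω, ENNReal.ofReal (W t ω) ∂P = ENNReal.ofReal ((1 - r * q) ^ t) := by
    intro t
    induction t with
    | zero => simp [hW]
    | succ t ih =>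
      have hx : 0 ≤ (1 - r * q) ^ t := pow_nonneg (by linarith) t
      have hWw : Measurable fun ω => ENNReal.ofReal (W t ω) * ENNReal.ofReal (w t ω) :=
        (hWm' t).ennreal_ofReal.mul (hwm t).ennreal_ofReal
      have hsplit : ∫⁻ ω, ENNReal.ofReal (W (t + 1) ω) ∂P
          + ENNReal.ofReal (r * q * (1 - r * q) ^ t) = ENNReal.ofReal ((1 - r * q) ^ t) := by
        rw [mul_assoc, ENNReal.ofReal_mul hr, ENNReal.ofReal_mul hq, ← ih,
          ← hw.lintegral_mul t _ (hWm t).ennreal_ofReal,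
          ← lintegral_const_mul _ hWw,
          ← lintegral_add_left (hWm' (t + 1)).ennreal_ofReal]
        refine lintegral_congr_ae ?_
        filter_upwards [hW0, hw.nonneg] with ω h0 h1
        rw [← ENNReal.ofReal_mul (h0 t), ← ENNReal.ofReal_mul hr,
          ← ENNReal.ofReal_add (h0 (t + 1)) (mul_nonneg hr (mul_nonneg (h0 t) (h1 t)))]
        congr 1
        simp only [hW, Finset.prod_range_succ]
        ring
      rw [ENNReal.eq_sub_of_add_eq ENNReal.ofReal_ne_top hsplit,
        ← ENNReal.ofReal_sub _ (mul_nonneg (mul_nonneg hr hq) hx)]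
      congr 1
      ring
  have hlt : ∀ᵐ ω ∂P, ∑' t, ENNReal.ofReal (Q ^ t * W t ω) < ⊤ := by
    have hm : ∀ t, Measurable fun ω => ENNReal.ofReal (Q ^ t * W t ω) := fun t =>
      ((hWm' t).const_mul _).ennreal_ofReal
    refine ae_lt_top (Measurable.tsum hm) ?_
    rw [lintegral_tsum fun t => (hm t).aemeasurable]
    have h1 : ∀ t : ℕ, ∫⁻ ω, ENNReal.ofReal (Q ^ t * W t ω) ∂P
        = ENNReal.ofReal ((Q * (1 - r * q)) ^ t) := by
      intro t
      simp_rw [ENNReal.ofReal_mul (pow_nonneg hQ t)]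
      rw [lintegral_const_mul _ (hWm' t).ennreal_ofReal, hI,
        ← ENNReal.ofReal_mul (pow_nonneg hQ t), mul_pow]
    simp_rw [h1]
    have h0 : 0 ≤ Q * (1 - r * q) := mul_nonneg hQ (by linarith)
    rw [← ENNReal.ofReal_tsum_of_nonneg (fun t => pow_nonneg h0 t)
      (summable_geometric_of_lt_one h0 hQ1)]
    exact ENNReal.ofReal_ne_top
  filter_upwards [hlt, hW0] with ω hω h0
  have h1 := ENNReal.tendsto_atTop_zero_of_tsum_ne_top hω.ne
  have h2 := (ENNReal.tendsto_toReal ENNReal.zero_ne_top).comp h1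
  refine h2.congr fun t => ?_
  exact ENNReal.toReal_ofReal (mul_nonneg (pow_nonneg hQ t) (h0 t))

/-! ### The Łojasiewicz inequality along a sequence -/

section Lojasiewicz

variable {n : ℕ} {θ κ ℓ : ℝ} {f : E n → ℝ}

theorem LojasiewiczAt.mono {κ' : ℝ} {xs : E n} (h : LojasiewiczAt θ κ f xs) (hκ : κ ≤ κ') :
    LojasiewiczAt θ κ' f xs := by
  obtain ⟨μ, hμ, H⟩ := h
  exact ⟨μ, hμ, fun x hx => (H x hx).trans (mul_le_mul_of_nonneg_right hκ (norm_nonneg _))⟩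

theorem LojasiewiczAt.eventually {xs : E n} (h : LojasiewiczAt θ κ f xs) :
    ∀ᶠ x in 𝓝 xs, |f x - f xs| ^ θ ≤ κ * ‖gradient f x‖ := by
  obtain ⟨μ, hμ, H⟩ := h
  filter_upwards [Metric.closedBall_mem_nhds xs hμ] with x hx
  exact H x (by simpa [dist_eq_norm] using hx)

/-- The Łojasiewicz constant can be chosen uniformly on compact sets of critical points. -/
theorem exists_lojasiewiczAt_of_isCompact {s : Set (E n)} (hs : IsCompact s)
    (h : ∀ x ∈ s, ∃ κ : ℝ, 0 < κ ∧ LojasiewiczAt θ κ f x) :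
    ∃ κ : ℝ, 0 < κ ∧ ∀ x ∈ s, gradient f x = 0 → LojasiewiczAt θ κ f x := by
  refine hs.induction_on (p := fun s => ∃ κ : ℝ, 0 < κ ∧
    ∀ x ∈ s, gradient f x = 0 → LojasiewiczAt θ κ f x) ⟨1, one_pos, by simp⟩ ?_ ?_ ?_
  · rintro s t hst ⟨κ, hκ, H⟩
    exact ⟨κ, hκ, fun x hx => H x (hst hx)⟩
  · rintro s t ⟨κ, hκ, H⟩ ⟨κ', hκ', H'⟩
    refine ⟨max κ κ', lt_max_of_lt_left hκ, fun x hx h0 => ?_⟩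
    rcases hx with hx | hx
    · exact (H x hx h0).mono (le_max_left _ _)
    · exact (H' x hx h0).mono (le_max_right _ _)
  · intro x hx
    obtain ⟨κ, hκ, μ, hμ, H⟩ := h x hx
    refine ⟨Metric.ball x μ, mem_nhdsWithin_of_mem_nhds (Metric.ball_mem_nhds x hμ), κ, hκ,
      fun y hy h0 => ?_⟩
    rw [Metric.mem_ball, dist_eq_norm] at hy
    -- The inequality at `x` forces critical points nearby to share the value `f x`, so it serves as
    -- the inequality at `y` on a smaller ball.
    have hfy : f y = f x := by
      have h1 := H y hy.le
      rw [h0, norm_zero, mul_zero] at h1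
      by_contra hne
      exact absurd h1 (not_le.2 (Real.rpow_pos_of_pos (abs_pos.2 (sub_ne_zero.2 hne)) θ))
    refine ⟨μ - ‖y - x‖, by linarith, fun z hz => ?_⟩
    rw [hfy]
    refine H z ?_
    have := norm_sub_le_norm_sub_add_norm_sub z y x
    linarith

/-- Along a bounded sequence of values converging to `ℓ` with vanishing gradients, the Łojasiewicz
inequality holds eventually with `ℓ` as the critical value. -/
theorem eventually_lojasiewicz (hf : Continuous f) (hf' : Continuous (gradient f))
    {s : Set (E n)} (hs : IsCompact s)
    (hκ : ∀ x ∈ s, gradient f x = 0 → LojasiewiczAt θ κ f x)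
    {y : ℕ → E n} (hy : ∀ t, y t ∈ s) (hfy : Tendsto (fun t => f (y t)) atTop (𝓝 ℓ))
    (hgy : Tendsto (fun t => gradient f (y t)) atTop (𝓝 0)) :
    ∀ᶠ t in atTop, |f (y t) - ℓ| ^ θ ≤ κ * ‖gradient f (y t)‖ := by
  -- A subsequence of failures would converge to a critical point with value `ℓ`, where the
  -- inequality holds nearby.
  by_contra hcon
  obtain ⟨σ, hσ, hσ'⟩ := extraction_of_frequently_atTop (not_eventually.1 hcon)
  obtain ⟨z, hz, ρ, hρ, hlim⟩ := hs.tendsto_subseq fun i => hy (σ i)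
  have hsub : Tendsto (fun i => σ (ρ i)) atTop atTop := hσ.tendsto_atTop.comp hρ.tendsto_atTop
  have hz0 : gradient f z = 0 :=
    tendsto_nhds_unique ((hf'.tendsto z).comp hlim) (hgy.comp hsub)
  have hfz : f z = ℓ := tendsto_nhds_unique ((hf.tendsto z).comp hlim) (hfy.comp hsub)
  obtain ⟨i, hi⟩ := (hlim.eventually (hκ z hz hz0).eventually).exists
  rw [hfz] at hi
  exact hσ' (ρ i) hi

theorem eventually_rpow_max_le {φ G : ℕ → ℝ} {θ' : ℝ} (hθ : 0 ≤ θ) (hθ' : θ ≤ θ')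
    (hφ : Tendsto φ atTop (𝓝 ℓ)) (h : ∀ᶠ t in atTop, |φ t - ℓ| ^ θ ≤ κ * G t) :
    ∀ᶠ t in atTop, |φ t - ℓ| ^ θ' ≤ κ * G t := by
  have h1 : Tendsto (fun t => |φ t - ℓ|) atTop (𝓝 0) := by
    simpa using (hφ.sub_const ℓ).abs
  filter_upwards [h, h1.eventually_lt_const one_pos] with t ht ht1
  exact (Real.rpow_le_rpow_of_exponent_ge' (abs_nonneg _) ht1.le hθ hθ').trans ht

end Lojasiewicz

/-! ### Rates along a path -/

section Rates

variable {c D κ θ ℓ : ℝ} {p G φ a : ℕ → ℝ}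

/-- At exponent `1/2` the recursion is linear. Allowing any `r` below the contraction factor lets
countably many `r` serve all outcomes when `κ` is random. -/
theorem IsExcess.tendsto_pow_mul (h : IsExcess c D p G φ ℓ a) (hc : 0 < c) (hD : 0 < D)
    (hκ : 0 < κ) (hp : ∀ t, 0 ≤ p t) (hp1 : ∀ t, p t ≤ 1)
    (hloj : ∀ᶠ t in atTop, |φ t - ℓ| ^ (1 / 2 : ℝ) ≤ κ * G t)
    {r Q : ℝ} (hr : 0 ≤ r) (hrc : r ≤ contraction c κ) (hQ : 0 ≤ Q)
    (hW : Tendsto (fun t : ℕ => Q ^ t * ∏ s ∈ Finset.range t, (1 - r * p s)) atTop (𝓝 0)) :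
    Tendsto (fun t : ℕ => Q ^ t * (φ t - ℓ)) atTop (𝓝 0) := by
  have h1 : ∀ᶠ t in atTop, a (t + 1) ≤ a t - r * p t * a t := by
    filter_upwards [h.eventually_le_sub hc hD hκ hp hp1 le_rfl (by norm_num) hloj] with t ht
    rw [mul_one_div_cancel two_ne_zero, Real.rpow_one] at ht
    have : r * p t * a t ≤ contraction c κ * p t * a t :=
      mul_le_mul_of_nonneg_right (mul_le_mul_of_nonneg_right hrc (hp t)) (h.pos t).le
    linarith
  obtain ⟨B, hB⟩ := exists_forall_le_mul_prod hr (hrc.trans (contraction_le hc)) hp1 h1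
  refine squeeze_zero_norm' ?_ (by simpa using hW.const_mul (5 * B))
  filter_upwards [hB] with t ht
  rw [norm_mul, Real.norm_of_nonneg (pow_nonneg hQ t), Real.norm_eq_abs]
  calc Q ^ t * |φ t - ℓ| ≤ Q ^ t * (5 * (B * ∏ s ∈ Finset.range t, (1 - r * p s))) := by
        refine mul_le_mul_of_nonneg_left ((h.abs_le t).trans ?_) (pow_nonneg hQ t)
        linarith
    _ = _ := by ring

theorem IsExcess.isBigO (h : IsExcess c D p G φ ℓ a) (hc : 0 < c) (hD : 0 < D)
    (hκ : 0 < κ) (hp : ∀ t, 0 ≤ p t) (hp1 : ∀ t, p t ≤ 1) (hθ : 1 / 2 < θ) (hθ' : θ < 1)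
    (hloj : ∀ᶠ t in atTop, |φ t - ℓ| ^ θ ≤ κ * G t) {Q : ℝ} (hQ : 1 < Q)
    (hW : Tendsto (fun t : ℕ => Q ^ t * ∏ s ∈ Finset.range t, (1 - 1 / 2 * p s)) atTop (𝓝 0)) :
    (fun t => φ t - ℓ) =O[atTop] fun t : ℕ => (t : ℝ) ^ (1 / (1 - 2 * θ)) := by
  obtain ⟨d, hd, hsum⟩ := exists_density_of_prod_tendsto hp hp1 hQ hW
  have h1 := h.eventually_le_sub hc hD hκ hp hp1 hθ.le hθ' hloj
  have h2 := isBigO_rpow_of_le_sub (β := 2 * θ - 1) (contraction_pos (κ := κ) hc) (by linarith)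
    (by linarith) h.pos (by simpa using h1) hd hsum
  have e : -(1 / (2 * θ - 1)) = 1 / (1 - 2 * θ) := by
    rw [← one_div_neg_eq_neg_one_div]; congr 1; ring
  rw [e] at h2
  refine IsBigO.trans (IsBigO.of_bound 5 (Eventually.of_forall fun t => ?_)) h2
  rw [Real.norm_eq_abs, Real.norm_of_nonneg (h.pos t).le]
  exact h.abs_le t

end Rates

theorem IsProjRatio.ae_summable {Ω : Type*} {m : MeasurableSpace Ω} {P : Measure Ω}
    [IsProbabilityMeasure P] {𝓕 : Filtration ℕ m} {q : ℝ} {w : ℕ → Ω → ℝ}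
    (hw : IsProjRatio P 𝓕 q w) (hq : 0 < q) {Y : ℕ → Ω → ℝ} (hY : ∀ t, Measurable[𝓕 t] (Y t))
    (hY0 : ∀ t ω, 0 ≤ Y t ω) {M : ℝ} (hb : ∀ᵐ ω ∂P, ∀ t, w t ω * Y t ω ≤ M) :
    ∀ᵐ ω ∂P, Summable (fun t => w t ω * Y t ω) → Summable fun t => Y t ω := by
  have hmul : ∀ t ω, ENNReal.ofReal (Y t ω) * ENNReal.ofReal (w t ω)
      = ENNReal.ofReal (w t ω * Y t ω) := fun t ω => by
    rw [← ENNReal.ofReal_mul (hY0 t ω), mul_comm]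
  have h := hw.ae_tsum_ne_top hq (Y := fun t ω => ENNReal.ofReal (Y t ω))
    (fun t => (hY t).ennreal_ofReal) (M₀ := ENNReal.ofReal M) ENNReal.ofReal_ne_top (by
      filter_upwards [hb] with ω hω t
      rw [hmul]
      exact ENNReal.ofReal_le_ofReal (hω t))
  filter_upwards [h] with ω hω hsum
  simp only [hmul] at hω
  have h1 := ENNReal.summable_toReal (hω hsum.tsum_ofReal_ne_top)
  exact h1.congr fun t => ENNReal.toReal_ofReal (hY0 t ω)

/-! ### The iterates -/

/-- The direction of `g`, with the default value `e` at `g = 0`. -/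
noncomputable def direction {n : ℕ} (e g : E n) : E n :=
  open Classical in if g = 0 then e else ‖g‖⁻¹ • g

theorem norm_direction {n : ℕ} {e : E n} (he : ‖e‖ = 1) (g : E n) : ‖direction e g‖ = 1 := by
  unfold direction
  split_ifs with h
  · exact he
  · rw [norm_smul, norm_inv, norm_norm, inv_mul_cancel₀ (norm_ne_zero_iff.2 h)]

theorem frameSq_eq_direction {n k : ℕ} (v : Fin k → E n) (e g : E n) :
    frameSq v g = frameSq v (direction e g) * ‖g‖ ^ 2 := by
  unfold direction
  split_ifs with h
  · simp [h, frameSq]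
  · have := norm_ne_zero_iff.2 h
    rw [frameSq_smul]
    field_simp

theorem measurable_direction {n : ℕ} (e : E n) : Measurable (direction e) :=
  Measurable.ite (measurableSet_singleton 0) measurable_const
    (measurable_norm.inv.smul measurable_id)

theorem continuous_gradEst {n k : ℕ} {f : E n → ℝ} (hf : Continuous f) (δ : ℝ) :
    Continuous fun z : (Fin k → E n) × E n => gradEst f δ z.1 z.2 := by
  unfold gradEst
  fun_prop

theorem IsStiefelSample.measurable_szgd {n k : ℕ} {Ω : Type*} [MeasurableSpace Ω] {P : Measure Ω}
    {V : ℕ → Ω → Fin k → E n} (hV : IsStiefelSample P V) {f : E n → ℝ} (hf : Continuous f)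
    (η δ₀ : ℝ) (x₀ : E n) (t : ℕ) :
    Measurable[past hV t] fun ω => szgd f η δ₀ x₀ (fun s => V s ω) t := by
  induction t with
  | zero => exact measurable_const
  | succ t ih =>
    have ih' := ih.mono ((past hV).mono t.le_succ) le_rfl
    exact (continuous_snd.sub ((continuous_gradEst hf _).const_smul η)).measurable.comp
      ((hV.measurable_past t).prodMk ih')

theorem IsStiefelSample.ae_mem {n k : ℕ} {Ω : Type*} [MeasurableSpace Ω] {P : Measure Ω}
    {V : ℕ → Ω → Fin k → E n} (hV : IsStiefelSample P V) :
    ∀ᵐ ω ∂P, ∀ t, V t ω ∈ stiefel n k :=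
  ae_all_iff.2 fun t => ae_of_ae_map (hV.measurable t).aemeasurable (hV.uniform t).ae_mem

theorem IsStiefelSample.isProjRatio {n k : ℕ} (hn : 0 < n) {Ω : Type*} [MeasurableSpace Ω]
    {P : Measure Ω} [IsProbabilityMeasure P] {V : ℕ → Ω → Fin k → E n}
    (hV : IsStiefelSample P V) {u : ℕ → Ω → E n} (hu : ∀ t, Measurable[past hV t] (u t))
    (hu1 : ∀ t ω, ‖u t ω‖ = 1) :
    IsProjRatio P (past hV) (k / n) fun t ω => frameSq (V t ω) (u t ω) where
  measurable t := measurable_frameSq (hV.measurable_past t)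
    ((hu t).mono ((past hV).mono t.le_succ) le_rfl)
  nonneg := ae_of_all _ fun _ _ => frameSq_nonneg _ _
  le_one := by
    filter_upwards [hV.ae_mem] with ω hω t
    simpa [hu1] using frameSq_le (hω t) (u t ω)
  lintegral_mul t _ hZ := hV.lintegral_mul_frameSq hn hZ (hu t) (hu1 t)

/-- Convergence of a path whose gradients are summable whenever their projections are. -/
theorem exists_tendsto_of_isExcess {n : ℕ} {f : E n → ℝ} (hf : Continuous f)
    (hf' : Continuous (gradient f)) (hloj : IsLojasiewicz θ f) {c D ℓ A A' : ℝ} (hc : 0 < c)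
    (hD : 0 < D) {y : ℕ → E n} {p a : ℕ → ℝ} (hp : ∀ t, 0 ≤ p t) (hp1 : ∀ t, p t ≤ 1)
    (hfy : Tendsto (fun t => f (y t)) atTop (𝓝 ℓ))
    (h : IsExcess c D p (fun t => ‖gradient f (y t)‖) (fun t => f (y t)) ℓ a)
    (hbdd : Bornology.IsBounded (Set.range y))
    (hsq : Summable (fun t => p t * ‖gradient f (y t)‖ ^ 2) →
      Summable fun t => ‖gradient f (y t)‖ ^ 2)
    (hlin : Summable (fun t => p t * ‖gradient f (y t)‖) → Summable fun t => ‖gradient f (y t)‖)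
    (hstep : ∀ t : ℕ, ‖y (t + 1) - y t‖ ≤ A * ‖gradient f (y t)‖ + A' * (1 / 2) ^ t) :
    ∃ z, Tendsto y atTop (𝓝 z) ∧ gradient f z = 0 := by
  obtain ⟨hθ, hθ1, -, hloj⟩ := hloj
  have hsum2 : Summable fun t => ‖gradient f (y t)‖ ^ 2 := by
    refine hsq (summable_of_sum_range_le (c := a 0 / c)
      (fun t => mul_nonneg (hp t) (sq_nonneg _)) fun t => ?_)
    rw [le_div_iff₀' hc, Finset.mul_sum]
    exact h.sum_le hD t
  have hG0 : Tendsto (fun t => gradient f (y t)) atTop (𝓝 0) := by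
    rw [tendsto_zero_iff_norm_tendsto_zero]
    simpa using hsum2.tendsto_atTop_zero.sqrt
  obtain ⟨R, hR⟩ := isBounded_iff_forall_norm_le.1 hbdd
  have hyR : ∀ t, y t ∈ Metric.closedBall (0 : E n) R := fun t =>
    mem_closedBall_zero_iff.2 (hR _ ⟨t, rfl⟩)
  have hcomp : IsCompact (Metric.closedBall (0 : E n) R ∩ {x | gradient f x = 0}) :=
    (isCompact_closedBall _ _).inter_right (isClosed_eq hf' continuous_const)
  obtain ⟨κ, hκ, Hκ⟩ := exists_lojasiewiczAt_of_isCompact hcomp fun x hx => hloj x hx.2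
  have hev := eventually_lojasiewicz (κ := κ) (θ := θ) hf hf' (isCompact_closedBall _ _)
    (fun x hx h0 => Hκ x ⟨hx, h0⟩ h0) hyR hfy hG0
  -- Raising the exponent to at least `1/2` makes the granularity errors summable.
  have hev' := eventually_rpow_max_le hθ.le (le_max_left θ (1 / 2)) hfy hev
  have hsum := hlin (h.summable_mul hc hD hκ hp hp1 (fun t => norm_nonneg _) (le_max_right _ _)
    (max_lt hθ1 (by norm_num)) hev')
  have hcau : CauchySeq y := by
    refine cauchySeq_of_summable_dist ?_
    refine Summable.of_nonneg_of_le (fun _ => dist_nonneg) (fun t => ?_)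
      ((hsum.mul_left A).add (summable_geometric_two.mul_left A'))
    rw [dist_comm, dist_eq_norm]
    exact hstep t
  obtain ⟨z, hz⟩ := cauchySeq_tendsto_of_complete hcau
  exact ⟨z, hz, tendsto_nhds_unique ((hf'.tendsto z).comp hz) hG0⟩

end SZGD

theorem theorem1 {n k : ℕ} (hk : 1 ≤ k) (hkn : k ≤ n)
    (f : SZGD.E n → ℝ) (L θ η δ₀ : ℝ) (x₀ : SZGD.E n)
    (hL : 0 < L) (hsmooth : SZGD.LSmooth L f) (hloj : SZGD.IsLojasiewicz θ f)
    (hbdd : BddBelow (Set.range f))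
    (hδ₀ : 0 < δ₀) (hδ₀' : δ₀ ≤ 1)
    (hη : 0 < η) (hη' : η < 2 * k / (L * n))
    {Ω : Type*} [MeasurableSpace Ω] (P : Measure Ω) [IsProbabilityMeasure P]
    (V : ℕ → Ω → Fin k → SZGD.E n) (hV : SZGD.IsStiefelSample P V)
    (x : ℕ → Ω → SZGD.E n)
    (hx : ∀ t ω, x t ω = SZGD.szgd f η δ₀ x₀ (fun s => V s ω) t)
    (hxbdd : ∀ᵐ ω ∂P, Bornology.IsBounded (Set.range fun t => x t ω)) :
    ∃ xInf : Ω → SZGD.E n, Measurable xInf ∧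
      -- almost sure convergence to a critical point
      (∀ᵐ ω ∂P, Tendsto (fun t => x t ω) atTop (𝓝 (xInf ω)) ∧ gradient f (xInf ω) = 0) ∧
      -- (a) linear rate
      (θ ≤ 1 / 2 → -1 ≤ L * n * η ^ 2 / (2 * k) - η → L * n * η ^ 2 / (2 * k) - η < 0 →
        (∀ᵐ ω ∂P, ∃ Q : ℝ, 1 < Q ∧
          Tendsto (fun t : ℕ => Q ^ t * (f (x t ω) - f (xInf ω))) atTop (𝓝 0)) ∧
        ((SZGD.HasUniformLojasiewiczConstant θ f ∨ ∃ R : ℝ, ∀ᵐ ω ∂P, ∀ t, ‖x t ω‖ ≤ R) →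
          ∃ Q : ℝ, 1 < Q ∧ ∀ᵐ ω ∂P,
            Tendsto (fun t : ℕ => Q ^ t * (f (x t ω) - f (xInf ω))) atTop (𝓝 0))) ∧
      -- (b) sublinear rate
      (1 / 2 < θ →
        ∀ᵐ ω ∂P, (fun t : ℕ => f (x t ω) - f (xInf ω)) =O[atTop]
          (fun t : ℕ => (t : ℝ) ^ (1 / (1 - 2 * θ)))) := by
  open SZGD in
  have hn : 0 < n := by omega
  have hf : Continuous f := hsmooth.1.continuous
  have hf' : Continuous (gradient f) := hsmooth.continuous_gradient
  obtain ⟨m, hm⟩ := hbdd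
  replace hm : ∀ y, m ≤ f y := fun y => hm ⟨y, rfl⟩
  obtain ⟨c, hc, C, hC, hdesc⟩ := hsmooth.exists_descent hL hk hn hη hη'
  -- Chosen so that `C * δ_t ^ 2 = D / 2 / 4 ^ t`.
  set D : ℝ := 2 * C * δ₀ ^ 2 with hDdef
  have hD : 0 < D := by positivity
  set q : ℝ := k / n
  have hn' : (0 : ℝ) < n := by exact_mod_cast hn
  have hk' : (0 : ℝ) < k := by exact_mod_cast hk
  have hq : 0 < q := by positivity
  have hq1 : q ≤ 1 := (div_le_one hn').2 (by exact_mod_cast hkn)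
  obtain ⟨e, he⟩ : ∃ e : E n, ‖e‖ = 1 := ⟨EuclideanSpace.single ⟨0, hn⟩ 1, by simp⟩
  have hxm : ∀ t, Measurable[past hV t] (x t) := fun t => by
    rw [show x t = _ from funext (hx t)]
    exact hV.measurable_szgd hf η δ₀ x₀ t
  have hgm : ∀ t, Measurable[past hV t] fun ω => gradient f (x t ω) := fun t =>
    hf'.measurable.comp (hxm t)
  -- The default direction `e` keeps the conditional mean equal to `k / n` even where the gradient
  -- vanishes.
  set w : ℕ → Ω → ℝ := fun t ω => frameSq (V t ω) (direction e (gradient f (x t ω))) with hwdef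
  have hw : IsProjRatio P (past hV) q w :=
    hV.isProjRatio hn (fun t => (measurable_direction e).comp (hgm t))
      fun t ω => norm_direction he _
  have hsucc : ∀ t ω, x (t + 1) ω = x t ω - η • gradEst f (δ₀ / 2 ^ t) (V t ω) (x t ω) := by
    intro t ω
    rw [hx, hx]
    rfl
  have hexc : ∀ᵐ ω ∂P, ∃ ℓ a, Tendsto (fun t => f (x t ω)) atTop (𝓝 ℓ) ∧
      IsExcess c D (fun t => w t ω) (fun t => ‖gradient f (x t ω)‖) (fun t => f (x t ω)) ℓ a ∧
      a 0 ≤ f x₀ + D - m := by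
    filter_upwards [hV.ae_mem] with ω hω
    obtain ⟨ℓ, a, h1, h2, h3⟩ := exists_isExcess (m := m) hc hD (p := fun t => w t ω)
      (G := fun t => ‖gradient f (x t ω)‖) (φ := fun t => f (x t ω))
      (fun t => frameSq_nonneg _ _) (fun t => hm _) fun t => by
        have := hdesc (δ₀ / 2 ^ t) (by positivity) (V t ω) (hω t) (x t ω)
        rw [← hsucc, frameSq_eq_direction _ e] at this
        refine this.trans (le_of_eq ?_)
        rw [hDdef, div_pow, ← pow_mul, mul_comm t 2, pow_mul]
        norm_num
        ring
    have h0 : x 0 ω = x₀ := hx 0 ω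
    rw [h0] at h3
    exact ⟨ℓ, a, h1, h2, h3⟩
  -- A non-random bound on each `p G²`, as the conditional Borel–Cantelli argument requires.
  set A : ℝ := (f x₀ + D - m) / c
  have hbsq : ∀ᵐ ω ∂P, ∀ t, w t ω * ‖gradient f (x t ω)‖ ^ 2 ≤ A := by
    filter_upwards [hexc] with ω ⟨ℓ, a, _, h2, h3⟩ t
    rw [le_div_iff₀' hc]
    refine le_trans ?_ ((h2.sum_le hD (t + 1)).trans h3)
    exact Finset.single_le_sum
      (f := fun s => c * (w s ω * ‖gradient f (x s ω)‖ ^ 2))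
      (fun s _ => mul_nonneg hc.le (mul_nonneg (frameSq_nonneg _ _) (sq_nonneg _)))
      (Finset.self_mem_range_succ t)
  have hblin : ∀ᵐ ω ∂P, ∀ t, w t ω * ‖gradient f (x t ω)‖ ≤ 1 + A := by
    filter_upwards [hbsq, hw.nonneg, hw.le_one] with ω h1 h2 h3 t
    have h4 : ‖gradient f (x t ω)‖ ≤ 1 + ‖gradient f (x t ω)‖ ^ 2 := by
      nlinarith [sq_nonneg (‖gradient f (x t ω)‖ - 1), norm_nonneg (gradient f (x t ω))]
    have h5 := mul_le_mul_of_nonneg_left h4 (h2 t)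
    linarith [h1 t, h3 t]
  have hlevy2 := hw.ae_summable hq (Y := fun t ω => ‖gradient f (x t ω)‖ ^ 2)
    (fun t => (continuous_norm.pow 2).measurable.comp (hgm t)) (fun _ _ => sq_nonneg _) hbsq
  have hlevy1 := hw.ae_summable hq (Y := fun t ω => ‖gradient f (x t ω)‖)
    (fun t => measurable_norm.comp (hgm t)) (fun _ _ => norm_nonneg _) hblin
  have hconv : ∀ᵐ ω ∂P, ∃ z, Tendsto (fun t => x t ω) atTop (𝓝 z) ∧ gradient f z = 0 := by
    filter_upwards [hV.ae_mem, hexc, hlevy2, hlevy1, hxbdd, hw.nonneg, hw.le_one]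
      with ω hω ⟨ℓ, a, h1, h2, _⟩ hl2 hl1 hb h0 h1'
    refine exists_tendsto_of_isExcess hf hf' hloj hc hD h0 h1' h1 h2 hb hl2 hl1
      (A := η * n) (A' := η * n * (L * δ₀ / 2)) fun t => ?_
    have h3 := hsmooth.norm_smul_gradEst_le hη.le (δ := δ₀ / 2 ^ t) (by positivity) (hω t) (x t ω)
    rw [hsucc, sub_sub_cancel_left, norm_neg]
    refine h3.trans (le_of_eq ?_)
    rw [div_pow, one_pow]
    field_simp
  obtain ⟨xInf, hxInf, hlim⟩ := measurable_limit_of_tendsto_metrizable_ae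
    (fun t => ((hxm t).mono ((past hV).le t) le_rfl).aemeasurable)
    (hconv.mono fun ω ⟨z, hz, _⟩ => ⟨z, hz⟩)
  have hcrit : ∀ᵐ ω ∂P, gradient f (xInf ω) = 0 := by
    filter_upwards [hconv, hlim] with ω ⟨z, hz, hz0⟩ hω
    rwa [tendsto_nhds_unique hω hz]
  have hexc' : ∀ᵐ ω ∂P, ∃ a, IsExcess c D (fun t => w t ω) (fun t => ‖gradient f (x t ω)‖)
      (fun t => f (x t ω)) (f (xInf ω)) a := by
    filter_upwards [hexc, hlim] with ω ⟨ℓ, a, h1, h2, _⟩ hω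
    rw [tendsto_nhds_unique ((hf.tendsto _).comp hω) h1]
    exact ⟨a, h2⟩
  have hgap : ∀ r : ℝ, 0 < r → r ≤ 1 / 2 → ∃ Q : ℝ, 1 < Q ∧ ∀ᵐ ω ∂P,
      Tendsto (fun t : ℕ => Q ^ t * ∏ s ∈ Finset.range t, (1 - r * w s ω)) atTop (𝓝 0) := by
    intro r hr hr1
    have h1 : 0 < r * q := by positivity
    have h2 : r * q ≤ 1 / 2 := by nlinarith
    -- Any `Q > 1` with `Q * (1 - r * q) < 1` would do.
    have hQ : 1 < 2 / (2 - r * q) := by rw [lt_div_iff₀ (by linarith)]; linarith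
    refine ⟨2 / (2 - r * q), hQ, hw.ae_tendsto_prod hq.le hq1 hr.le (by linarith) (by linarith) ?_⟩
    rw [div_mul_eq_mul_div, div_lt_one (by linarith)]
    linarith
  have hlojhalf : ∀ {κ : ℝ} {ω : Ω}, θ ≤ 1 / 2 → LojasiewiczAt θ κ f (xInf ω) →
      Tendsto (fun t => x t ω) atTop (𝓝 (xInf ω)) →
      ∀ᶠ t in atTop, |f (x t ω) - f (xInf ω)| ^ (1 / 2 : ℝ) ≤ κ * ‖gradient f (x t ω)‖ :=
    fun hθ hκ hω => eventually_rpow_max_le hloj.1.le hθ ((hf.tendsto _).comp hω)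
      (hω.eventually hκ.eventually)
  refine ⟨xInf, hxInf, hlim.and hcrit, fun hθ _ _ => ⟨?_, fun huni => ?_⟩, fun hθ => ?_⟩
  -- Here `κ` depends on the outcome. The rates `r = 1 / (j + 2)` share one null set, and `j` is
  -- picked afterwards with `r` below the contraction factor.
  · choose Q hQ hQW using fun j : ℕ => hgap (1 / (j + 2)) (by positivity)
      (one_div_le_one_div_of_le two_pos (by linarith [(Nat.cast_nonneg j : (0 : ℝ) ≤ j)]))
    filter_upwards [hlim, hcrit, hexc', ae_all_iff.2 hQW, hw.nonneg, hw.le_one]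
      with ω hω h0 ⟨a, ha⟩ hW hp hp1
    obtain ⟨κ, hκ, hκL⟩ := hloj.2.2.2 _ h0
    obtain ⟨j, hj⟩ := exists_nat_one_div_lt (contraction_pos (κ := κ) hc)
    refine ⟨Q j, hQ j, ha.tendsto_pow_mul hc hD hκ hp hp1 (hlojhalf hθ hκL hω) (by positivity)
      (le_trans ?_ hj.le) (by linarith [hQ j]) (hW j)⟩
    exact one_div_le_one_div_of_le (by positivity) (by linarith)
  · obtain ⟨κ, hκ, hκL⟩ : ∃ κ : ℝ, 0 < κ ∧ ∀ᵐ ω ∂P, LojasiewiczAt θ κ f (xInf ω) := by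
      rcases huni with ⟨κ, hκ, H⟩ | ⟨R, hR⟩
      · exact ⟨κ, hκ, hcrit.mono fun ω h0 => H _ h0⟩
      -- With a deterministic bound, all limits lie in one compact set of critical points, which has
      -- a common `κ`.
      · have hcomp : IsCompact (Metric.closedBall (0 : E n) R ∩ {y | gradient f y = 0}) :=
          (isCompact_closedBall _ _).inter_right (isClosed_eq hf' continuous_const)
        obtain ⟨κ, hκ, H⟩ := exists_lojasiewiczAt_of_isCompact hcomp
          fun y hy => hloj.2.2.2 y hy.2
        refine ⟨κ, hκ, ?_⟩
        filter_upwards [hlim, hcrit, hR] with ω hω h0 hRω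
        refine H _ ⟨mem_closedBall_zero_iff.2 ?_, h0⟩ h0
        exact le_of_tendsto' hω.norm hRω
    obtain ⟨Q, hQ, hQW⟩ := hgap _ (contraction_pos (κ := κ) hc) (contraction_le hc)
    refine ⟨Q, hQ, ?_⟩
    filter_upwards [hlim, hκL, hexc', hQW, hw.nonneg, hw.le_one] with ω hω hκω ⟨a, ha⟩ hW hp hp1
    exact ha.tendsto_pow_mul hc hD hκ hp hp1 (hlojhalf hθ hκω hω) (contraction_pos hc).le le_rfl
      (by linarith) hW
  -- The product only measures the density of `w`, so one fixed `r` works for every `κ`.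
  · obtain ⟨Q, hQ, hQW⟩ := hgap (1 / 2) (by norm_num) le_rfl
    filter_upwards [hlim, hcrit, hexc', hQW, hw.nonneg, hw.le_one]
      with ω hω h0 ⟨a, ha⟩ hW hp hp1
    obtain ⟨κ, hκ, hκL⟩ := hloj.2.2.2 _ h0
    exact ha.isBigO hc hD hκ hp hp1 hθ hloj.2.1 (hω.eventually hκL.eventually) hQ hW
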